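/- There is a universal constant $K>0$ such that the following holds. Let $(E,\rho)$ be a metric space with its Borel $\sigma$-algebra, let $d\ge 1$ be an integer, and let $\mu$ be a Borel probability measure on $E$ without atoms (every measurable set of positive measure contains a measurable subset of strictly smaller positive measure). Let $X_1,\dots,X_d$ be independent random variables with values in $E$ and law $\mu$, defined on a probability space $(\Omega,\mathbf P)$. Let $T$ be a (not necessarily countable) class of Borel measurable functions $t:E\to[0,\infty)$ such that the function $(x_1,\dots,x_d)\mapsto\sup_{t\in T}\sum_{i=1}^d t(x_i)\in[0,\infty]$ is measurable with respect to the $\mu^{\otimes d}$-completion of the product $\sigma$-algebra on $E^d$ (this is automatic if $T$ is countable), and suppose that $$S:=\mathbf E\sup_{t\in T}\sum_{i=1}^d t(X_i)\quad\text{satisfies}\quad 0<S<\infty .$$ Then there exists a countable family $\mathcal F$ of pairs $(g,u)$, where each $g:E\to[0,\infty)$ is Borel measurable and $u\ge 0$, such that $$\Big\{\sup_{t\in T}\sum_{i=1}^d t(X_i)\ge K S\Big\}\subset\bigcup_{(g,u)\in\mathcal F}\Big\{\frac1d\sum_{i=1}^d g(X_i)\ge u\Big\}$$ and $$\sum_{(g,u)\in\mathcal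 F}\mathbf P\Big(\frac1d\sum_{i=1}^d g(X_i)\ge u\Big)\le\frac12 .$$ -/

import Mathlib

open MeasureTheory ProbabilityTheory
open scoped NNReal ENNReal

/-- A measure has no atoms: every measurable set of positive measure contains a measurable
subset of strictly smaller positive measure. -/
def HasNoAtoms {E : Type*} [MeasurableSpace E] (μ : Measure E) : Prop :=
  ∀ A : Set E, MeasurableSet A → 0 < μ A →
    ∃ B ⊆ A, MeasurableSet B ∧ 0 < μ B ∧ μ B < μ A

/-- The value at `(x₁, …, x_d)` of the supremum over `t ∈ T` of `∑ᵢ t(xᵢ)`, in `[0, ∞]`. -/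
noncomputable def supSum {E : Type*} {d : ℕ} (T : Set (E → ℝ≥0)) (x : Fin d → E) : ℝ≥0∞ :=
  ⨆ t ∈ T, ∑ i, (t (x i) : ℝ≥0∞)

/-! The argument discretises the process and then runs a minimal-fragment argument in the spirit of
Park and Pham, with scales.

Since `μ` has no atoms, `E` splits into finitely many cells so small that a sample rarely hits one
twice. By a first-moment choice (`exists_cells_representatives`), one point per cell can be fixed so
that the process on these points has mean at most `2 * S` over injective families, and a large value
at `x` passes to the representatives of its cells, except on a set of tiny outer measure. That set
is covered by rectangles, and a rectangle lies in a half-space whose measure is larger by a factor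
of at most `(1 + d) ^ d` (`exists_halfSpace_cover`). This loss is harmless because the cells are
chosen after `d`.

For the main part, list the cells of a large value by decreasing `t`; the initial segments form a
chain. Let `W` be the set of cells hit by `768` independent samples of size `d`. If at every scale
`W` contains at least half of the segment, Abel summation shows that `W` carries half of the sum,
which Markov's inequality makes unlikely. Otherwise the chain contains a fragment `U`: the minimal
remainder outside `W` of some chain at a scale `m < 2 * U.card` (`exists_fragment_subset`). Given `Z
= W ∪ U` and the size of `U`, there are at most `2 ^ m` choices of `U`
(`card_fragment_decompositions_le`), so the fragments are cheap on average (`sum_fragmentCost_le`).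

A point meeting every cell of `U` lies in a half-space of measure at most `(3 * d) ^ U.card` times
the product of the cell measures, by a Chernoff bound with weights `log (1 / (d * μ C))`
(`exists_halfSpace_cells`). A good `W` makes these half-spaces cost at most `1 / 4` in total; the
exceptional set costs another `1 / 4`. -/

/-- At every scale `l > m` at most half of the `l`-th member of the chain `P h` lies outside `W`. -/
def Captured {α ι : Type*} [DecidableEq ι] (P : α → ℕ → Finset ι) (d m : ℕ) (W : Finset ι)
    (h : α) : Prop :=
  ∀ l, m < l → l ≤ d → 2 * (P h l \ W).card ≤ l

/-- The minimal parts outside `W` of the `m`-th members of chains captured by `W` above scale `m`,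
among those with more than `m / 2` elements. -/
def fragments {α ι : Type*} [DecidableEq ι] (H : Set α) (P : α → ℕ → Finset ι) (d m : ℕ)
    (W : Finset ι) : Set (Finset ι) :=
  {U | (∃ h ∈ H, Captured P d m W h ∧ P h m \ W = U) ∧ m < 2 * U.card ∧
    ∀ g ∈ H, Captured P d m W g → P g m \ W ⊆ U → P g m \ W = U}

/-! ### Fragments of chains -/

section Fragments

variable {α ι : Type*} [DecidableEq ι] {H : Set α} {P : α → ℕ → Finset ι} {d m : ℕ}
  {W U : Finset ι}

theorem disjoint_of_mem_fragments (hU : U ∈ fragments H P d m W) : Disjoint W U := by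
  obtain ⟨⟨h, -, -, rfl⟩, -⟩ := hU
  exact Finset.disjoint_sdiff

theorem card_le_of_mem_fragments (hcard : ∀ h l, (P h l).card ≤ l)
    (hU : U ∈ fragments H P d m W) : U.card ≤ m := by
  obtain ⟨⟨h, -, -, rfl⟩, -⟩ := hU
  exact (Finset.card_le_card Finset.sdiff_subset).trans (hcard h m)

/-- Take the least scale `m` at which some chain captured above `m` has its remainder inside `P h₀
d`. Scale `d` qualifies vacuously, scale `0` is excluded by `hW`, and leastness forces more than `m
/ 2` elements to remain. -/
theorem exists_fragment_subset (hmono : ∀ h, Monotone (P h))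
    (hW : ∀ h ∈ H, ¬ Captured P d 0 W h) {h₀ : α} (h₀H : h₀ ∈ H) :
    ∃ m, 1 ≤ m ∧ m ≤ d ∧ ∃ U ∈ fragments H P d m W, U ⊆ P h₀ d := by
  classical
  let Q : ℕ → Prop := fun m => m ≤ d ∧ ∃ h ∈ H, Captured P d m W h ∧ P h m \ W ⊆ P h₀ d
  have hQ : ∃ m, Q m :=
    ⟨d, le_rfl, h₀, h₀H, fun l hl hl' => absurd hl (by omega), Finset.sdiff_subset⟩
  obtain ⟨hmd, hex⟩ := Nat.find_spec hQ
  set m := Nat.find hQ with hm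
  have hm0 : m ≠ 0 := by
    intro h0
    obtain ⟨h, hH, hc, -⟩ := hex
    exact hW h hH (h0 ▸ hc)
  -- A second minimisation, over the size of the remainder at this scale, gives the minimality
  -- required of a fragment.
  let R : ℕ → Prop := fun u => ∃ h ∈ H, Captured P d m W h ∧ P h m \ W ⊆ P h₀ d ∧
    (P h m \ W).card = u
  have hR : ∃ u, R u := by
    obtain ⟨h, hH, hc, hs⟩ := hex
    exact ⟨_, h, hH, hc, hs, rfl⟩
  obtain ⟨h, hH, hc, hs, hu⟩ := Nat.find_spec hR
  refine ⟨m, Nat.one_le_iff_ne_zero.2 hm0, hmd, P h m \ W, ⟨⟨h, hH, hc, rfl⟩, ?_, ?_⟩, hs⟩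
  · by_contra hlt
    -- With at most `m / 2` elements left, the same chain would be captured above `m - 1`.
    have hlow : Q (m - 1) := by
      refine ⟨by omega, h, hH, ?_, ?_⟩
      · intro l hl hl'
        rcases eq_or_ne l m with rfl | hne
        · exact not_lt.1 hlt
        · exact hc l (by omega) hl'
      · exact (Finset.sdiff_subset_sdiff (hmono h (Nat.sub_le m 1)) subset_rfl).trans hs
    have := Nat.find_min' hQ hlow
    omega
  · intro g hg hgc hgs
    have : R (P g m \ W).card := ⟨g, hg, hgc, hgs.trans hs, rfl⟩
    exact Finset.eq_of_subset_of_card_le hgs (hu ▸ Nat.find_min' hR this)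

/-- One chain `g` witnessing a single decomposition serves for all of them: it is captured by `Z \
U` for every admissible `U`, so minimality of `U` forces `U ⊆ P g m`. -/
theorem card_fragment_decompositions_le (hmono : ∀ h, Monotone (P h))
    (hcard : ∀ h l, (P h l).card ≤ l) (Z : Finset ι) (m u : ℕ) (D : Finset (Finset ι))
    (hD : ∀ U ∈ D, U ⊆ Z ∧ U.card = u ∧ U ∈ fragments H P d m (Z \ U)) :
    D.card ≤ 2 ^ m := by
  rcases D.eq_empty_or_nonempty with rfl | ⟨V, hV⟩
  · simp
  obtain ⟨hVZ, hVu, ⟨g, hgH, hgc, hgV⟩, -, -⟩ := hD V hV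
  have hgZ : P g m ⊆ Z := by
    intro a ha
    by_contra haZ
    have : a ∈ P g m \ (Z \ V) := by simp [ha, haZ]
    exact haZ (hVZ (hgV ▸ this))
  have hVg : V ⊆ P g m := by rw [← hgV]; exact Finset.sdiff_subset
  -- The capture bound for `Z \ V` involves `V` only through its size `u`, so it can be transferred
  -- to every other `U` of that size.
  have hbound : ∀ l, m < l → l ≤ d → 2 * ((P g l \ Z).card + u) ≤ l := by
    intro l hl hl'
    refine le_trans ?_ (hgc l hl hl')
    have hdisj : Disjoint (P g l \ Z) V :=
      Finset.disjoint_of_subset_right hVZ Finset.sdiff_disjoint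
    rw [← hVu, ← Finset.card_union_of_disjoint hdisj]
    refine Nat.mul_le_mul_left _ (Finset.card_le_card ?_)
    refine Finset.union_subset (Finset.sdiff_subset_sdiff subset_rfl Finset.sdiff_subset) ?_
    intro a ha
    simp [ha, hmono g hl.le (hVg ha)]
  have hsub : D ⊆ (P g m).powerset := by
    intro U hU
    obtain ⟨hUZ, hUu, -, -, hmin⟩ := hD U hU
    have hsd : ∀ l, P g l \ (Z \ U) ⊆ (P g l \ Z) ∪ U := by
      intro l a ha
      simp only [Finset.mem_sdiff, Finset.mem_union] at ha ⊢
      tauto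
    have hcap : Captured P d m (Z \ U) g := by
      intro l hl hl'
      refine le_trans (Nat.mul_le_mul_left _ ?_) (hbound l hl hl')
      exact (Finset.card_le_card (hsd l)).trans (hUu ▸ Finset.card_union_le _ _)
    have hU' : P g m \ (Z \ U) ⊆ U := by
      refine (hsd m).trans ?_
      rw [Finset.sdiff_eq_empty_iff_subset.2 hgZ, Finset.empty_union]
    rw [Finset.mem_powerset, ← hmin g hgH hcap hU']
    exact Finset.sdiff_subset
  calc D.card ≤ (P g m).powerset.card := Finset.card_le_card hsub
    _ = 2 ^ (P g m).card := Finset.card_powerset _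
    _ ≤ 2 ^ m := Nat.pow_le_pow_right (by norm_num) (hcard g m)

end Fragments

/-! ### Abel summation against antitone sequences -/

theorem mul_sum_range_le_sum_range_mul {a : ℕ → ℝ} (ha : Antitone a) (s : ℕ → ℝ)
    (hs : ∀ n, 0 ≤ ∑ i ∈ Finset.range n, s i) (n : ℕ) :
    a n * ∑ i ∈ Finset.range n, s i ≤ ∑ i ∈ Finset.range n, a i * s i := by
  induction n with
  | zero => simp
  | succ n ih =>
    rw [Finset.sum_range_succ (fun i => a i * s i)]
    -- Only here is the nonnegativity of partial sums needed: it allows the larger factor `a n` to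
    -- be lowered to `a (n + 1)`.
    have h1 : a (n + 1) * ∑ i ∈ Finset.range (n + 1), s i
        ≤ a n * ∑ i ∈ Finset.range (n + 1), s i :=
      mul_le_mul_of_nonneg_right (ha (Nat.le_succ n)) (hs _)
    rw [Finset.sum_range_succ, mul_add] at h1
    rw [Finset.sum_range_succ]
    linarith

/-- If at most half of every initial segment is missing from `I`, then `I` carries at least half of
the sum of an antitone sequence. -/
theorem sum_le_two_mul_sum_of_antitone {d : ℕ} {a : Fin d → ℝ≥0} (ha : Antitone a)
    (I : Finset (Fin d))
    (hI : ∀ l ≤ d, 2 * (Finset.univ.filter fun i : Fin d => (i : ℕ) < l ∧ i ∉ I).card ≤ l) :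
    ∑ i, a i ≤ 2 * ∑ i ∈ I, a i := by
  let b : ℕ → ℝ := fun n => if h : n < d then a ⟨n, h⟩ else 0
  -- With sign `1` on `I` and `-1` off it, `hI` says that the partial sums are nonnegative and the
  -- conclusion says that `∑ a i * s i ≥ 0`.
  let s : ℕ → ℝ := fun n => if h : n < d then (if (⟨n, h⟩ : Fin d) ∈ I then 1 else -1) else 0
  have hb : Antitone b := by
    intro m n hmn
    by_cases hn : n < d
    · have hm : m < d := by omega
      simp only [b, hn, hm, dif_pos]
      exact_mod_cast ha (by exact hmn)
    · simp only [b, hn, dif_neg, not_false_iff]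
      split_ifs <;> positivity
  have hsum : ∀ f : Fin d → ℝ, ∀ l ≤ d, ∑ i ∈ Finset.range l, (if h : i < d then f ⟨i, h⟩ else 0)
      = ∑ i ∈ Finset.univ.filter (fun i : Fin d => (i : ℕ) < l), f i := by
    intro f l hl
    symm
    refine Finset.sum_bij (fun i _ => (i : ℕ)) ?_ ?_ ?_ ?_
    · intro i hi; simpa using hi
    · intro i _ j _ hij; exact Fin.ext hij
    · intro n hn
      have hn' := Finset.mem_range.1 hn
      exact ⟨⟨n, by omega⟩, by simpa using hn', rfl⟩
    · intro i _; simp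
  have hs' : ∀ l ≤ d, 0 ≤ ∑ i ∈ Finset.range l, s i := by
    intro l hl
    rw [hsum (fun i => if i ∈ I then (1 : ℝ) else -1) l hl, Finset.sum_ite]
    simp only [Finset.sum_const, nsmul_eq_mul, mul_one, mul_neg, Finset.filter_filter]
    have h1 := hI l hl
    have h2 : (Finset.univ.filter fun i : Fin d => (i : ℕ) < l ∧ i ∈ I).card
        + (Finset.univ.filter fun i : Fin d => (i : ℕ) < l ∧ i ∉ I).card = l := by
      have := Finset.card_filter_add_card_filter_not
        (s := Finset.univ.filter fun i : Fin d => (i : ℕ) < l) (fun i => i ∈ I)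
      rw [Finset.filter_filter, Finset.filter_filter, Fin.card_filter_val_lt] at this
      omega
    have h3 : (Finset.univ.filter fun i : Fin d => (i : ℕ) < l ∧ i ∉ I).card
        ≤ (Finset.univ.filter fun i : Fin d => (i : ℕ) < l ∧ i ∈ I).card := by omega
    have h4 : ((Finset.univ.filter fun i : Fin d => (i : ℕ) < l ∧ i ∉ I).card : ℝ)
        ≤ (Finset.univ.filter fun i : Fin d => (i : ℕ) < l ∧ i ∈ I).card := by exact_mod_cast h3
    linarith
  have hs : ∀ n, 0 ≤ ∑ i ∈ Finset.range n, s i := by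
    intro n
    rcases le_total n d with h | h
    · exact hs' n h
    · rw [← Finset.sum_subset (Finset.range_subset_range.2 h)]
      · exact hs' d le_rfl
      · intro i _ hi
        have : ¬ i < d := by simpa using hi
        simp [s, this]
  have key := mul_sum_range_le_sum_range_mul hb s hs d
  have h0 : 0 ≤ ∑ i ∈ Finset.range d, b i * s i := by
    refine le_trans ?_ key
    simp [b]
  have h1 : ∑ i ∈ Finset.range d, b i * s i
      = ∑ i : Fin d, (a i : ℝ) * (if i ∈ I then 1 else -1) := by
    have := hsum (fun i => (a i : ℝ) * (if i ∈ I then 1 else -1)) d le_rfl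
    rw [Finset.filter_true_of_mem (fun i _ => i.2)] at this
    rw [← this]
    refine Finset.sum_congr rfl fun i hi => ?_
    have hi' := Finset.mem_range.1 hi
    simp [b, s, hi']
  rw [h1] at h0
  have h2 : ∑ i : Fin d, (a i : ℝ) * (if i ∈ I then 1 else -1)
      = 2 * ∑ i ∈ I, (a i : ℝ) - ∑ i, (a i : ℝ) := by
    have : ∀ i, (a i : ℝ) * (if i ∈ I then 1 else -1)
        = 2 * (if i ∈ I then (a i : ℝ) else 0) - a i := by
      intro i; split_ifs <;> ring
    rw [Finset.sum_congr rfl fun i _ => this i, Finset.sum_sub_distrib, ← Finset.mul_sum]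
    simp
  rw [h2] at h0
  have h3 : ∑ i, (a i : ℝ) ≤ 2 * ∑ i ∈ I, (a i : ℝ) := by linarith
  exact_mod_cast h3

/-! ### Injective families and subsets -/

theorem card_injective_image_eq {κ ι : Type*} [Fintype κ] [Fintype ι] [DecidableEq κ]
    [DecidableEq ι] (W : Finset ι) (hW : W.card = Fintype.card κ)
    [DecidablePred fun A : κ → ι => Function.Injective A ∧ Finset.univ.image A = W] :
    (Finset.univ.filter fun A : κ → ι => Function.Injective A ∧ Finset.univ.image A = W).card
      = (Fintype.card κ).factorial := by
  have hcard : Fintype.card κ = Fintype.card W := by simp [hW]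
  rw [← Fintype.card_equiv (Fintype.equivOfCardEq hcard), ← Finset.card_univ]
  symm
  refine Finset.card_bij (fun (e : κ ≃ W) _ => fun k => (e k : ι)) ?_ ?_ ?_
  · intro e _
    simp only [Finset.mem_filter, Finset.mem_univ, true_and]
    refine ⟨fun i j hij => e.injective (Subtype.ext hij), ?_⟩
    ext a
    simp only [Finset.mem_image, Finset.mem_univ, true_and]
    refine ⟨fun ⟨k, hk⟩ => hk ▸ (e k).2, fun ha => ⟨e.symm ⟨a, ha⟩, by simp⟩⟩
  · intro e _ e' _ h
    ext k
    exact congrFun h k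
  · intro A hA
    simp only [Finset.mem_filter, Finset.mem_univ, true_and] at hA
    have hmem : ∀ k, A k ∈ W := fun k => hA.2 ▸ Finset.mem_image_of_mem A (Finset.mem_univ k)
    refine ⟨Equiv.ofBijective (fun k => ⟨A k, hmem k⟩) ?_, Finset.mem_univ _, rfl⟩
    rw [Fintype.bijective_iff_injective_and_card]
    exact ⟨fun i j hij => hA.1 (congrArg Subtype.val hij), hcard⟩

open Classical in
/-- Sums over injective families agree with sums over subsets, up to a factorial. -/
theorem sum_injective_eq_factorial_mul {κ ι : Type*} [Fintype κ] [DecidableEq κ] [Fintype ι]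
    (b : ι → ℝ≥0∞) (h : Finset ι → ℝ≥0∞) :
    ∑ A : κ → ι with Function.Injective A, (∏ j, b (A j)) * h (Finset.univ.image A)
      = ((Fintype.card κ).factorial : ℝ≥0∞) *
        ∑ W ∈ Finset.powersetCard (Fintype.card κ) Finset.univ, (∏ a ∈ W, b a) * h W := by
  rw [Finset.mul_sum, ← Finset.sum_fiberwise_of_maps_to
    (t := Finset.powersetCard (Fintype.card κ) (Finset.univ : Finset ι))
    (g := fun A : κ → ι => Finset.univ.image A)]
  · refine Finset.sum_congr rfl fun W hW => ?_
    rw [Finset.filter_filter, ← card_injective_image_eq W (Finset.mem_powersetCard.1 hW).2,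
      ← nsmul_eq_mul]
    refine Finset.sum_eq_card_nsmul fun A hA => ?_
    simp only [Finset.mem_filter, Finset.mem_univ, true_and] at hA
    rw [← hA.2, Finset.prod_image fun i _ j _ hij => hA.1 hij]
  · intro A hA
    simp only [Finset.mem_filter, Finset.mem_univ, true_and] at hA
    rw [Finset.mem_powersetCard]
    exact ⟨Finset.subset_univ _, by rw [Finset.card_image_of_injective _ hA, Finset.card_univ]⟩

/-- Expanding the `n`-th power of `∑ b ≤ 1`, the injective words contribute each `n`-subset exactly
`n!` times. -/
theorem factorial_mul_sum_powersetCard_le {ι : Type*} [Fintype ι] (b : ι → ℝ≥0∞)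
    (hb : ∑ a, b a ≤ 1) (n : ℕ) :
    (n.factorial : ℝ≥0∞) * ∑ W ∈ Finset.powersetCard n Finset.univ, ∏ a ∈ W, b a ≤ 1 := by
  classical
  have h := sum_injective_eq_factorial_mul (κ := Fin n) b (fun _ => 1)
  rw [Fintype.card_fin] at h
  simp only [mul_one] at h
  have h2 : ∑ A : Fin n → ι with Function.Injective A, (∏ j, b (A j)) ≤ 1 := by
    calc _ ≤ ∑ A : Fin n → ι, ∏ j, b (A j) :=
          Finset.sum_le_sum_of_subset (Finset.filter_subset _ _)
      _ = ∏ _j : Fin n, ∑ a, b a := by rw [Finset.prod_univ_sum]; simp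
      _ ≤ 1 := Finset.prod_le_one' fun _ _ => hb
  rw [← h]
  convert h2

/-! ### Average cost of fragments -/

-- The pairs `(W, U)` are regrouped by their union `Z`; each `Z` occurs at most `2 ^ m` times.
open Classical in
theorem sum_fragment_cost_scale_le {α ι : Type*} [Fintype ι] {H : Set α}
    {P : α → ℕ → Finset ι} (hmono : ∀ h, Monotone (P h)) (hcard : ∀ h l, (P h l).card ≤ l)
    (d m M u : ℕ) (b : ι → ℝ≥0∞) (hb : ∑ a, b a ≤ 1) :
    ∑ W ∈ Finset.powersetCard M Finset.univ, (∏ a ∈ W, b a) *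
        ∑ U : Finset ι with U ∈ fragments H P d m W ∧ U.card = u, ∏ a ∈ U, b a
      ≤ 2 ^ m / ((M + u).factorial : ℝ≥0∞) := by
  simp_rw [Finset.mul_sum]
  rw [Finset.sum_sigma']
  calc _ = ∑ x ∈ (Finset.powersetCard M (Finset.univ : Finset ι)).sigma
        (fun W => Finset.univ.filter fun U => U ∈ fragments H P d m W ∧ U.card = u),
          ∏ a ∈ x.1 ∪ x.2, b a := by
        refine Finset.sum_congr rfl fun x hx => ?_
        simp only [Finset.mem_sigma, Finset.mem_filter, Finset.mem_univ, true_and] at hx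
        rw [Finset.prod_union (disjoint_of_mem_fragments hx.2.1)]
    _ ≤ ∑ y ∈ (Finset.powersetCard (M + u) (Finset.univ : Finset ι)).sigma
        (fun Z => Finset.univ.filter fun U =>
          U ⊆ Z ∧ U.card = u ∧ U ∈ fragments H P d m (Z \ U)), ∏ a ∈ y.1, b a := by
        -- Keeping `U` next to the union makes the map injective: `W` and `U` are disjoint, so `W`
        -- is the difference.
        let φ : (Σ _ : Finset ι, Finset ι) → (Σ _ : Finset ι, Finset ι) :=
          fun x => ⟨x.1 ∪ x.2, x.2⟩
        have hx' : ∀ x ∈ (Finset.powersetCard M (Finset.univ : Finset ι)).sigma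
            (fun W => Finset.univ.filter fun U => U ∈ fragments H P d m W ∧ U.card = u),
            (x.1 ∪ x.2) \ x.2 = x.1 := by
          intro x hx
          simp only [Finset.mem_sigma, Finset.mem_filter, Finset.mem_univ, true_and] at hx
          exact Finset.union_sdiff_cancel_right (disjoint_of_mem_fragments hx.2.1)
        rw [← Finset.sum_image (s := (Finset.powersetCard M (Finset.univ : Finset ι)).sigma
            (fun W => Finset.univ.filter fun U => U ∈ fragments H P d m W ∧ U.card = u))
            (g := φ) (f := fun y => ∏ a ∈ y.1, b a)]
        · refine Finset.sum_le_sum_of_subset ?_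
          intro y hy
          obtain ⟨x, hx, rfl⟩ := Finset.mem_image.1 hy
          have h1 := hx' x hx
          simp only [Finset.mem_sigma, Finset.mem_filter, Finset.mem_univ, true_and,
            Finset.mem_powersetCard, Finset.subset_univ] at hx ⊢
          refine ⟨?_, Finset.subset_union_right, hx.2.2, ?_⟩
          · rw [Finset.card_union_of_disjoint (disjoint_of_mem_fragments hx.2.1), hx.1, hx.2.2]
          · simp only [φ]
            rw [h1]
            exact hx.2.1
        · intro x hx y hy hxy
          have h2 : x.2 = y.2 := by simpa [φ] using congrArg Sigma.snd hxy
          have h1 : x.1 ∪ x.2 = y.1 ∪ y.2 := by simpa [φ] using congrArg Sigma.fst hxy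
          have h3 : x.1 = y.1 := by rw [← hx' x hx, ← hx' y hy, h1, h2]
          cases x; cases y
          simp only at h2 h3
          rw [h2, h3]
    _ = ∑ Z ∈ Finset.powersetCard (M + u) (Finset.univ : Finset ι),
          ((Finset.univ.filter fun U =>
            U ⊆ Z ∧ U.card = u ∧ U ∈ fragments H P d m (Z \ U)).card : ℝ≥0∞)
              * ∏ a ∈ Z, b a := by
        rw [Finset.sum_sigma]
        simp [Finset.sum_const, nsmul_eq_mul]
    _ ≤ ∑ Z ∈ Finset.powersetCard (M + u) (Finset.univ : Finset ι), 2 ^ m * ∏ a ∈ Z, b a := by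
        refine Finset.sum_le_sum fun Z _ => mul_le_mul_left ?_ _
        have := card_fragment_decompositions_le (d := d) (H := H) hmono hcard Z m u
          (Finset.univ.filter fun U => U ⊆ Z ∧ U.card = u ∧ U ∈ fragments H P d m (Z \ U))
          (fun U hU => by simpa using hU)
        exact_mod_cast this
    _ ≤ 2 ^ m / ((M + u).factorial : ℝ≥0∞) := by
        rw [← Finset.mul_sum, div_eq_mul_inv]
        refine mul_le_mul_right ?_ _
        rw [ENNReal.le_inv_iff_mul_le, mul_comm]
        exact factorial_mul_sum_powersetCard_le b hb _

open Classical in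
/-- The total cost of the sets which are fragments at some scale `1 ≤ m ≤ d`. -/
noncomputable def fragmentCost {α ι : Type*} [Fintype ι] (H : Set α) (P : α → ℕ → Finset ι)
    (d : ℕ) (b : ι → ℝ≥0∞) (c : ℝ≥0∞) (W : Finset ι) : ℝ≥0∞ :=
  ∑ m ∈ Finset.Icc 1 d, ∑ U : Finset ι with U ∈ fragments H P d m W, c ^ U.card * ∏ a ∈ U, b a

/-- Here `2 ^ m ≤ 4 ^ u`, and the quotient of factorials is at least `(768 * d) ^ u`; the constant
is `768 = 3 * 4 * 64`. -/
theorem factorial_mul_cost_term_le {d m u : ℕ} (hmu : m < 2 * u) :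
    ((768 * d).factorial : ℝ≥0∞) * ((3 * d : ℝ≥0∞) ^ u * (2 ^ m /
      ((768 * d + u).factorial : ℝ≥0∞))) ≤ (64⁻¹ : ℝ≥0∞) ^ u := by
  rw [← ENNReal.inv_pow, ENNReal.le_inv_iff_mul_le]
  have h1 : (768 * d).factorial * ((3 * d) ^ u * 2 ^ m) * 64 ^ u ≤ (768 * d + u).factorial := by
    calc _ ≤ (768 * d).factorial * ((3 * d) ^ u * 4 ^ u) * 64 ^ u := by
          have : 2 ^ m ≤ 4 ^ u := by
            rw [show 4 = 2 ^ 2 by norm_num, ← pow_mul]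
            exact Nat.pow_le_pow_right (by norm_num) hmu.le
          gcongr
      _ = (768 * d).factorial * (768 * d) ^ u := by
          rw [mul_assoc, ← mul_pow, ← mul_pow]; congr 2; ring
      _ ≤ (768 * d).factorial * (768 * d + 1) ^ u := by gcongr; omega
      _ ≤ _ := Nat.factorial_mul_pow_le_factorial
  have h2 : ((768 * d).factorial : ℝ≥0∞) * ((3 * d : ℝ≥0∞) ^ u * 2 ^ m) * 64 ^ u
      ≤ ((768 * d + u).factorial : ℝ≥0∞) := by exact_mod_cast h1
  calc _ = ((768 * d).factorial : ℝ≥0∞) * ((3 * d : ℝ≥0∞) ^ u * 2 ^ m) * 64 ^ u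
        / ((768 * d + u).factorial : ℝ≥0∞) := by
        simp only [div_eq_mul_inv]; ring
    _ ≤ 1 := ENNReal.div_le_of_le_mul (by rwa [one_mul])

/-- For each `u` at most `2 * u - 1 ≤ 2 ^ u` scales contribute, leaving a geometric series of ratio
`1 / 32`. -/
theorem sum_pow_inv_le (d : ℕ) :
    ∑ m ∈ Finset.Icc 1 d, ∑ u ∈ Finset.Icc 1 d,
      (if m < 2 * u then (64⁻¹ : ℝ≥0∞) ^ u else 0) ≤ 1 / 8 := by
  rw [Finset.sum_comm]
  calc _ ≤ ∑ u ∈ Finset.Icc 1 d, (32⁻¹ : ℝ≥0∞) ^ u := by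
        refine Finset.sum_le_sum fun u hu => ?_
        rw [← Finset.sum_filter, Finset.sum_const, nsmul_eq_mul]
        have hc : ((Finset.Icc 1 d).filter fun m => m < 2 * u).card ≤ 2 ^ u := by
          have h1 : ((Finset.Icc 1 d).filter fun m => m < 2 * u) ⊆ Finset.Ico 1 (2 * u) := by
            intro m hm
            simp only [Finset.mem_filter, Finset.mem_Icc, Finset.mem_Ico] at hm ⊢
            omega
          refine (Finset.card_le_card h1).trans ?_
          rw [Nat.card_Ico]
          have h2 : u ≤ 2 ^ (u - 1) := by
            have := Nat.lt_two_pow_self (n := u - 1)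
            omega
          have h3 : 2 ^ u = 2 * 2 ^ (u - 1) := by
            obtain ⟨v, rfl⟩ := Nat.exists_eq_add_of_le (Finset.mem_Icc.1 hu).1
            rw [pow_add]; simp
          omega
        calc _ ≤ ((2 ^ u : ℕ) : ℝ≥0∞) * 64⁻¹ ^ u := by gcongr
          _ = (32⁻¹ : ℝ≥0∞) ^ u := by
            push_cast
            rw [← mul_pow]
            congr 1
            rw [show (64 : ℝ≥0∞) = 2 * 32 by norm_num,
              ENNReal.mul_inv (Or.inl (by norm_num)) (Or.inl (by norm_num)), ← mul_assoc,
              ENNReal.mul_inv_cancel (by norm_num) (by norm_num), one_mul]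
    _ ≤ ∑ u ∈ Finset.range d, (32⁻¹ : ℝ≥0∞) ^ (u + 1) := by
        refine le_of_eq ?_
        symm
        refine Finset.sum_nbij' (fun u => u + 1) (fun u => u - 1) ?_ ?_ ?_ ?_ ?_ <;>
          intro u hu <;> simp at hu ⊢ <;> omega
    _ ≤ ∑' u : ℕ, (32⁻¹ : ℝ≥0∞) ^ (u + 1) := ENNReal.sum_le_tsum _
    _ ≤ 1 / 8 := by
        simp_rw [pow_succ]
        rw [ENNReal.tsum_mul_right, ENNReal.tsum_geometric]
        have h : (1 - 32⁻¹ : ℝ≥0∞)⁻¹ ≤ 2 := by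
          rw [ENNReal.inv_le_iff_inv_le]
          refine ENNReal.le_sub_of_add_le_left (by simp) ?_
          rw [← ENNReal.toReal_le_toReal (by simp [ENNReal.add_eq_top]) (by simp)]
          rw [ENNReal.toReal_add (by simp) (by simp)]
          norm_num
        calc _ ≤ 2 * (32⁻¹ : ℝ≥0∞) := by gcongr
          _ ≤ 1 / 8 := by
            rw [← ENNReal.toReal_le_toReal (by simp [ENNReal.mul_eq_top])
              (by simp)]
            norm_num

/-- The factorial turns the sum over `W` into a sum over injective samples of size `768 * d`.
Fragments at scale `m` have size between `m / 2` and `m`, so splitting by size `1 ≤ u ≤ d` loses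
nothing. -/
theorem sum_fragmentCost_le {α ι : Type*} [Fintype ι] {H : Set α}
    {P : α → ℕ → Finset ι} (hmono : ∀ h, Monotone (P h)) (hcard : ∀ h l, (P h l).card ≤ l)
    (d : ℕ) (b : ι → ℝ≥0∞) (hb : ∑ a, b a ≤ 1) :
    ((768 * d).factorial : ℝ≥0∞) * ∑ W ∈ Finset.powersetCard (768 * d) Finset.univ,
      (∏ a ∈ W, b a) * fragmentCost H P d b (3 * d) W ≤ 1 / 8 := by
  classical
  refine le_trans (le_of_eq_of_le ?_ (Finset.sum_le_sum fun m hm => Finset.sum_le_sum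
    (f := fun u => ((768 * d).factorial : ℝ≥0∞) * ((3 * d : ℝ≥0∞) ^ u *
      ∑ W ∈ Finset.powersetCard (768 * d) Finset.univ, (∏ a ∈ W, b a) *
        ∑ U : Finset ι with U ∈ fragments H P d m W ∧ U.card = u, ∏ a ∈ U, b a))
      fun u hu => ?_)) (sum_pow_inv_le d)
  · simp only [fragmentCost]
    simp_rw [← Finset.mul_sum]
    congr 1
    simp_rw [Finset.mul_sum (Finset.Icc 1 d)]
    rw [Finset.sum_comm]
    refine Finset.sum_congr rfl fun m hm => ?_
    simp_rw [Finset.mul_sum (Finset.powersetCard _ _)]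
    rw [Finset.sum_comm]
    refine Finset.sum_congr rfl fun W hW => ?_
    simp_rw [mul_left_comm _ (∏ a ∈ W, b a)]
    rw [← Finset.mul_sum]
    congr 1
    rw [← Finset.sum_fiberwise_of_maps_to (t := Finset.Icc 1 d) (g := Finset.card)]
    · refine Finset.sum_congr rfl fun u hu => ?_
      rw [Finset.filter_filter, Finset.mul_sum]
      refine Finset.sum_congr rfl fun U hU => ?_
      rw [(Finset.mem_filter.1 hU).2.2]
    · intro U hU
      have hU' := (Finset.mem_filter.1 hU).2
      have h1 := card_le_of_mem_fragments hcard hU'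
      have h2 := hU'.2.1
      have h3 := Finset.mem_Icc.1 hm
      rw [Finset.mem_Icc]
      omega
  · split_ifs with h
    · refine le_trans ?_ (factorial_mul_cost_term_le (d := d) h)
      gcongr
      exact sum_fragment_cost_scale_le hmono hcard d m _ u b hb
    · rw [Finset.sum_eq_zero, mul_zero, mul_zero]
      intro W _
      rw [Finset.filter_false_of_mem, Finset.sum_empty, mul_zero]
      intro U _ hU
      have := hU.1.2.1
      omega

/-! ### Small partitions for atomless measures -/

section NoAtoms

variable {E : Type*} [MeasurableSpace E] {μ : Measure E}

/-- A proper piece and its complement both have positive measure, and the smaller of them has at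
most half of the total. -/
theorem HasNoAtoms.exists_subset_measure_le_mul_pow [IsFiniteMeasure μ] (h : HasNoAtoms μ)
    {A : Set E} (hA : MeasurableSet A) (hA0 : 0 < μ A) (n : ℕ) :
    ∃ B ⊆ A, MeasurableSet B ∧ 0 < μ B ∧ μ B ≤ μ A * 2⁻¹ ^ n := by
  induction n with
  | zero => exact ⟨A, subset_rfl, hA, hA0, by simp⟩
  | succ n ih =>
    obtain ⟨B, hBA, hB, hB0, hBn⟩ := ih
    obtain ⟨C, hCB, hC, hC0, hCB'⟩ := h B hB hB0
    have hsum : μ C + μ (B \ C) = μ B := by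
      rw [measure_sdiff hCB hC.nullMeasurableSet (measure_ne_top _ _)]
      exact add_tsub_cancel_of_le (measure_mono hCB)
    have hD0 : 0 < μ (B \ C) := by
      rw [pos_iff_ne_zero]
      intro h0
      rw [h0, add_zero] at hsum
      exact hCB'.ne hsum
    have hkey : ∀ D ⊆ B, MeasurableSet D → 0 < μ D → 2 * μ D ≤ μ B →
        ∃ B ⊆ A, MeasurableSet B ∧ 0 < μ B ∧ μ B ≤ μ A * 2⁻¹ ^ (n + 1) := by
      intro D hDB hD hD0 hD2
      refine ⟨D, hDB.trans hBA, hD, hD0, ?_⟩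
      calc μ D = 2 * μ D * 2⁻¹ := by
            rw [mul_comm 2, mul_assoc, ENNReal.mul_inv_cancel (by norm_num) (by norm_num), mul_one]
        _ ≤ μ A * 2⁻¹ ^ n * 2⁻¹ := by exact mul_le_mul_left (hD2.trans hBn) _
        _ = _ := by rw [pow_succ, mul_assoc]
    rcases le_total (μ C) (μ (B \ C)) with hle | hle
    · refine hkey C hCB hC hC0 ?_
      rw [two_mul]
      exact (add_le_add_right hle _).trans hsum.le
    · refine hkey (B \ C) Set.sdiff_subset (hB.diff hC) hD0 ?_
      rw [two_mul]
      exact (add_le_add_left hle _).trans hsum.le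

theorem HasNoAtoms.exists_subset_measure_le [IsFiniteMeasure μ] (h : HasNoAtoms μ)
    {A : Set E} (hA : MeasurableSet A) (hA0 : 0 < μ A) {δ : ℝ≥0∞} (hδ : δ ≠ 0) :
    ∃ B ⊆ A, MeasurableSet B ∧ 0 < μ B ∧ μ B ≤ δ := by
  obtain ⟨n, hn⟩ := ENNReal.exists_inv_two_pow_lt
    (ENNReal.div_ne_zero.2 ⟨hδ, measure_ne_top μ A⟩)
  obtain ⟨B, hBA, hB, hB0, hBn⟩ := h.exists_subset_measure_le_mul_pow hA hA0 n
  refine ⟨B, hBA, hB, hB0, hBn.trans ?_⟩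
  calc _ ≤ μ A * (δ / μ A) := by gcongr
    _ ≤ δ := ENNReal.mul_div_le

/-- Every set has a subset of measure at most `δ` which is maximal up to a factor two. -/
theorem exists_subset_measure_almost_maximal [IsFiniteMeasure μ] (A : Set E) (δ : ℝ≥0∞) :
    ∃ B ⊆ A, MeasurableSet B ∧ μ B ≤ δ ∧
      ∀ C ⊆ A, MeasurableSet C → μ C ≤ δ → μ C ≤ 2 * μ B := by
  let s : ℝ≥0∞ := ⨆ C : {C : Set E // C ⊆ A ∧ MeasurableSet C ∧ μ C ≤ δ}, μ C
  have hs : ∀ C ⊆ A, MeasurableSet C → μ C ≤ δ → μ C ≤ s := fun C h1 h2 h3 =>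
    le_iSup (fun C : {C : Set E // C ⊆ A ∧ MeasurableSet C ∧ μ C ≤ δ} => μ C) ⟨C, h1, h2, h3⟩
  rcases eq_or_ne s 0 with h0 | h0
  · exact ⟨∅, Set.empty_subset _, .empty, by simp, fun C h1 h2 h3 =>
      (hs C h1 h2 h3).trans (by simp [h0])⟩
  · have hsfin : s ≠ ∞ :=
      ne_top_of_le_ne_top (measure_ne_top μ Set.univ) (iSup_le fun C => measure_mono (Set.subset_univ _))
    obtain ⟨⟨B, h1, h2, h3⟩, hB⟩ := lt_iSup_iff.1 (ENNReal.half_lt_self h0 hsfin)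
    refine ⟨B, h1, h2, h3, fun C k1 k2 k3 => (hs C k1 k2 k3).trans ?_⟩
    have : s / 2 ≤ μ B := hB.le
    rw [ENNReal.div_le_iff (by norm_num) (by norm_num)] at this
    rwa [mul_comm]

/-- A finite measure without atoms admits finite measurable partitions into small pieces. -/
theorem HasNoAtoms.exists_measurable_fin_measure_le [IsFiniteMeasure μ] (h : HasNoAtoms μ)
    {δ : ℝ≥0∞} (hδ : δ ≠ 0) :
    ∃ (n : ℕ) (c : E → Fin n), Measurable c ∧ ∀ a, μ (c ⁻¹' {a}) ≤ δ := by
  choose B hBsub hBmeas hBδ hBmax using fun A : Set E =>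
    exists_subset_measure_almost_maximal (μ := μ) A δ
  let R : ℕ → Set E := fun n => Nat.rec Set.univ (fun _ A => A \ B A) n
  have hRsucc : ∀ n, R (n + 1) = R n \ B (R n) := fun _ => rfl
  have hRmeas : ∀ n, MeasurableSet (R n) := by
    intro n
    induction n with
    | zero => exact MeasurableSet.univ
    | succ n ih => exact ih.diff (hBmeas _)
  have hRanti : Antitone R := antitone_nat_of_succ_le fun n => Set.sdiff_subset
  have hdisj : Pairwise (Function.onFun Disjoint fun n => B (R n)) := by
    rw [pairwise_disjoint_on]
    intro m n hmn
    refine Set.disjoint_of_subset_right ((hBsub _).trans (hRanti (Nat.succ_le_of_lt hmn))) ?_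
    exact Set.disjoint_sdiff_right
  have hsum : ∑' n, μ (B (R n)) ≠ ∞ := by
    rw [← measure_iUnion hdisj fun n => hBmeas _]
    exact measure_ne_top _ _
  have hlim := ENNReal.tendsto_atTop_zero_of_tsum_ne_top hsum
  -- A small piece of positive measure surviving every removal would have competed at each step, so
  -- its measure is at most twice that of every removed piece; these tend to zero.
  have hRinf : μ (⋂ n, R n) = 0 := by
    by_contra hne
    obtain ⟨C, hC, hCm, hC0, hCδ⟩ := h.exists_subset_measure_le
      (MeasurableSet.iInter hRmeas) (pos_iff_ne_zero.2 hne) hδ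
    have hle : ∀ n, μ C ≤ 2 * μ (B (R n)) := fun n =>
      hBmax _ C (hC.trans (Set.iInter_subset _ _)) hCm hCδ
    have := ge_of_tendsto' (ENNReal.Tendsto.const_mul hlim (Or.inr (by norm_num))) hle
    simp at this
    exact hC0.ne' this
  have hRlim := tendsto_measure_iInter_atTop (μ := μ) (fun n => (hRmeas n).nullMeasurableSet)
    hRanti ⟨0, measure_ne_top _ _⟩
  rw [hRinf] at hRlim
  obtain ⟨N, hN⟩ := (hRlim.eventually (gt_mem_nhds (pos_iff_ne_zero.2 hδ))).exists
  -- The partition is built backwards: the remainder `R N` is one class, and the removed pieces are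
  -- restored one by one with new labels.
  have hgood : ∀ k ≤ N, ∃ (n : ℕ) (c : E → ℕ), Measurable c ∧ (∀ x, c x < n) ∧
      ∀ a, μ (R (N - k) ∩ c ⁻¹' {a}) ≤ δ := by
    intro k
    induction k with
    | zero =>
      intro _
      exact ⟨1, fun _ => 0, measurable_const, fun _ => one_pos, fun a =>
        (measure_mono Set.inter_subset_left).trans hN.le⟩
    | succ k ih =>
      intro hk
      obtain ⟨n, c, hc, hcn, hca⟩ := ih (by omega)
      have hr : R (N - k) = R (N - (k + 1)) \ B (R (N - (k + 1))) := by
        rw [← hRsucc, show N - (k + 1) + 1 = N - k by omega]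
      set A := R (N - (k + 1))
      classical
      refine ⟨n + 1, fun x => if x ∈ B A then n else c x,
        Measurable.ite (hBmeas _) measurable_const hc, ?_, ?_⟩
      · intro x
        have := hcn x
        dsimp only
        split_ifs <;> omega
      · intro a
        rcases eq_or_ne a n with rfl | ha
        · refine (measure_mono ?_).trans (hBδ A)
          rintro x ⟨-, hx⟩
          by_contra hxB
          have := hcn x
          simp [hxB] at hx
          omega
        · refine (measure_mono ?_).trans (hca a)
          rintro x ⟨hxA, hx⟩
          by_cases hxB : x ∈ B A
          · simp [hxB] at hx
            exact absurd hx.symm ha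
          · rw [hr]
            exact ⟨⟨hxA, hxB⟩, by simpa [hxB] using hx⟩
  obtain ⟨n, c, hc, hcn, hca⟩ := hgood N le_rfl
  refine ⟨n, fun x => ⟨c x, hcn x⟩, ?_, fun a => ?_⟩
  · refine measurable_to_countable' fun a => ?_
    have : (fun x => (⟨c x, hcn x⟩ : Fin n)) ⁻¹' {a} = c ⁻¹' {(a : ℕ)} := by
      ext x
      simp [Fin.ext_iff]
    rw [this]
    exact hc (measurableSet_singleton _)
  · refine (measure_mono ?_).trans (hca a)
    intro x hx
    have hR0 : R (N - N) = Set.univ := by rw [Nat.sub_self]; rfl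
    rw [hR0, Set.univ_inter]
    simpa [Fin.ext_iff] using hx

end NoAtoms

/-! ### Half-spaces and the Chernoff bound -/

section HalfSpaces

variable {E : Type*} {κ : Type*}

open Classical in
/-- The function equal to the largest `log (r a)` with `a ∈ U` and `x ∈ C a`. -/
noncomputable def logWeight (U : Finset κ) (C : κ → Set E) (r : κ → ℝ≥0) (x : E) : ℝ≥0 :=
  U.sup fun a => if x ∈ C a then (Real.log (r a)).toNNReal else 0

theorem measurable_logWeight [MeasurableSpace E] (U : Finset κ) {C : κ → Set E} (hC : ∀ a ∈ U, MeasurableSet (C a))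
    (r : κ → ℝ≥0) : Measurable (logWeight U C r) := by
  classical
  unfold logWeight
  induction U using Finset.induction_on with
  | empty => simp
  | insert a U _ ih =>
    simp only [Finset.sup_insert]
    exact (Measurable.ite (hC a (by simp)) measurable_const measurable_const).sup
      (ih fun b hb => hC b (by simp [hb]))

theorem le_logWeight {U : Finset κ} {C : κ → Set E} {r : κ → ℝ≥0} {x : E} {a : κ} (ha : a ∈ U)
    (hx : x ∈ C a) : (Real.log (r a)).toNNReal ≤ logWeight U C r x := by
  classical
  unfold logWeight
  refine le_trans (le_of_eq ?_)
    (Finset.le_sup (f := fun a => if x ∈ C a then (Real.log (r a)).toNNReal else 0) ha)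
  rw [if_pos hx]

/-- Using the maximum of the logarithms, not their sum, keeps the exponential bounded linearly in
the `r a` even where the sets overlap. -/
theorem ofReal_exp_logWeight_le {U : Finset κ} {C : κ → Set E} {r : κ → ℝ≥0}
    (hr : ∀ a ∈ U, 1 ≤ r a) (x : E) :
    ENNReal.ofReal (Real.exp (logWeight U C r x))
      ≤ 1 + ∑ a ∈ U, (C a).indicator (fun _ => (r a : ℝ≥0∞)) x := by
  classical
  rcases U.eq_empty_or_nonempty with rfl | hU
  · simp [logWeight]
  obtain ⟨a, ha, hmax⟩ := Finset.exists_mem_eq_sup U hU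
    fun a => if x ∈ C a then (Real.log (r a)).toNNReal else 0
  unfold logWeight
  rw [hmax]
  split_ifs with hx
  · have h1 : (1 : ℝ) ≤ r a := hr a ha
    rw [Real.coe_toNNReal _ (Real.log_nonneg h1), Real.exp_log (by linarith),
      ENNReal.ofReal_coe_nnreal]
    refine le_trans ?_ (le_add_left (Finset.single_le_sum (fun _ _ => zero_le) ha))
    rw [Set.indicator_of_mem hx]
  · simp

/-- Chernoff bound for the half-space attached to the sets `C a` and the weights `log (r a)`. -/
theorem pi_halfspace_logWeight_le [MeasurableSpace E] {μ : Measure E} [IsProbabilityMeasure μ] (d : ℕ) (U : Finset κ) {C : κ → Set E}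
    (hC : ∀ a ∈ U, MeasurableSet (C a)) {r : κ → ℝ≥0} (hr : ∀ a ∈ U, 1 ≤ r a) :
    (Measure.pi fun _ : Fin d => μ)
        {x | ∑ a ∈ U, (Real.log (r a)).toNNReal ≤ ∑ j, logWeight U C r (x j)}
      ≤ (1 + ∑ a ∈ U, μ (C a) * r a) ^ d * ∏ a ∈ U, (r a : ℝ≥0∞)⁻¹ := by
  have hg := measurable_logWeight U hC r
  let e : E → ℝ≥0∞ := fun x => ENNReal.ofReal (Real.exp (logWeight U C r x))
  have he : Measurable e := by fun_prop
  have hprod : ∫⁻ x : Fin d → E, ∏ j, e (x j) ∂(Measure.pi fun _ : Fin d => μ)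
      = (∫⁻ x, e x ∂μ) ^ d := by
    have h1 := lintegral_prod_eq_prod_lintegral_of_indepFun
      (μ := Measure.pi fun _ : Fin d => μ) Finset.univ (fun j x => e (x j))
      (iIndepFun_pi (X := fun _ => e) fun _ => he.aemeasurable)
      (fun j => he.comp (measurable_pi_apply j))
    rw [h1]
    have h2 : ∀ j : Fin d, ∫⁻ x : Fin d → E, e (x j) ∂(Measure.pi fun _ : Fin d => μ)
        = ∫⁻ x, e x ∂μ := fun j =>
      (measurePreserving_eval (fun _ : Fin d => μ) j).lintegral_comp he
    simp [h2]
  have he1 : ∫⁻ x, e x ∂μ ≤ 1 + ∑ a ∈ U, μ (C a) * r a := by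
    calc _ ≤ ∫⁻ x, (1 + ∑ a ∈ U, (C a).indicator (fun _ => (r a : ℝ≥0∞)) x) ∂μ :=
          lintegral_mono fun x => ofReal_exp_logWeight_le hr x
      _ = 1 + ∑ a ∈ U, μ (C a) * r a := by
          rw [lintegral_add_left measurable_const, lintegral_finsetSum' U fun a ha =>
            (measurable_const.indicator (hC a ha)).aemeasurable]
          simp only [lintegral_const, measure_univ, mul_one]
          congr 1
          refine Finset.sum_congr rfl fun a ha => ?_
          rw [lintegral_indicator_const (hC a ha), mul_comm]
  have hsub : {x : Fin d → E | ∑ a ∈ U, (Real.log (r a)).toNNReal ≤ ∑ j, logWeight U C r (x j)}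
      ⊆ {x | ∏ a ∈ U, (r a : ℝ≥0∞) ≤ ∏ j, e (x j)} := by
    intro x hx
    have h1 : ∏ a ∈ U, (r a : ℝ≥0∞)
        = ENNReal.ofReal (Real.exp (∑ a ∈ U, ((Real.log (r a)).toNNReal : ℝ))) := by
      rw [Real.exp_sum, ENNReal.ofReal_prod_of_nonneg fun _ _ => (Real.exp_pos _).le]
      refine Finset.prod_congr rfl fun a ha => ?_
      have h1 : (1 : ℝ) ≤ r a := hr a ha
      rw [Real.coe_toNNReal _ (Real.log_nonneg h1), Real.exp_log (by linarith),
        ENNReal.ofReal_coe_nnreal]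
    have h2 : ∏ j, e (x j) = ENNReal.ofReal (Real.exp (∑ j, (logWeight U C r (x j) : ℝ))) := by
      rw [Real.exp_sum, ENNReal.ofReal_prod_of_nonneg fun _ _ => (Real.exp_pos _).le]
    rw [Set.mem_ofPred_eq, h1, h2]
    refine ENNReal.ofReal_le_ofReal (Real.exp_le_exp.2 ?_)
    exact_mod_cast hx
  have hr0 : ∏ a ∈ U, (r a : ℝ≥0∞) ≠ 0 := by
    refine Finset.prod_ne_zero_iff.2 fun a ha => ?_
    have : r a ≠ 0 := (lt_of_lt_of_le one_pos (hr a ha)).ne'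
    exact_mod_cast this
  have hrt : ∏ a ∈ U, (r a : ℝ≥0∞) ≠ ∞ := ENNReal.prod_ne_top fun _ _ => ENNReal.coe_ne_top
  have hinv : ∏ a ∈ U, (r a : ℝ≥0∞)⁻¹ = (∏ a ∈ U, (r a : ℝ≥0∞))⁻¹ := by
    rw [ENNReal.prod_inv_distrib]
    intro a _ b _ _
    exact Or.inr ENNReal.coe_ne_top
  rw [hinv, ← div_eq_mul_inv, ENNReal.le_div_iff_mul_le (Or.inl hr0) (Or.inl hrt), mul_comm]
  calc _ ≤ (∏ a ∈ U, (r a : ℝ≥0∞)) * (Measure.pi fun _ : Fin d => μ)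
          {x | ∏ a ∈ U, (r a : ℝ≥0∞) ≤ ∏ j, e (x j)} := by gcongr
    _ ≤ ∫⁻ x : Fin d → E, ∏ j, e (x j) ∂(Measure.pi fun _ : Fin d => μ) :=
        mul_meas_ge_le_lintegral (Finset.measurable_prod _ fun j _ =>
          he.comp (measurable_pi_apply j)) _
    _ ≤ _ := by rw [hprod]; gcongr

/-- A point meeting the sets `C a`, `a ∈ U`, at distinct coordinates lies in the half-space. -/
theorem sum_log_le_sum_logWeight {d : ℕ} {U : Finset κ} {C : κ → Set E} {r : κ → ℝ≥0}
    {x : Fin d → E} (φ : κ → Fin d) (hφ : Set.InjOn φ U) (hx : ∀ a ∈ U, x (φ a) ∈ C a) :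
    ∑ a ∈ U, (Real.log (r a)).toNNReal ≤ ∑ j, logWeight U C r (x j) := by
  classical
  calc _ ≤ ∑ a ∈ U, logWeight U C r (x (φ a)) :=
        Finset.sum_le_sum fun a ha => le_logWeight ha (hx a ha)
    _ = ∑ j ∈ U.image φ, logWeight U C r (x j) := by
        rw [Finset.sum_image hφ]
    _ ≤ _ := Finset.sum_le_sum_of_subset (Finset.subset_univ _)

end HalfSpaces

/-! ### Covering by rectangles -/

theorem exists_rectangle_cover {E : Type*} [MeasurableSpace E] (μ : Measure E) {d : ℕ} (hd : 0 < d)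
    (s : Set (Fin d → E)) (hs : (Measure.pi fun _ : Fin d => μ) s ≠ ∞) {ε : ℝ≥0∞} (hε : ε ≠ 0) :
    ∃ B : ℕ → Fin d → Set E, (∀ k i, MeasurableSet (B k i)) ∧
      s ⊆ ⋃ k, Set.univ.pi (B k) ∧
      ∑' k, ∏ i, μ (B k i) ≤ (Measure.pi fun _ : Fin d => μ) s + ε := by
  have h1 : OuterMeasure.pi (fun _ : Fin d => μ.toOuterMeasure) s
      < (Measure.pi fun _ : Fin d => μ) s + ε := by
    refine lt_of_le_of_lt ?_ (ENNReal.lt_add_right hs hε)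
    rw [Measure.pi]
    exact le_toMeasure_apply _ _ _
  rw [OuterMeasure.pi, OuterMeasure.boundedBy_apply] at h1
  simp only [iInf_lt_iff] at h1
  obtain ⟨t, hst, ht⟩ := h1
  have hpre : ∀ k, ∏ i, μ (toMeasurable μ (Function.eval i '' t k))
      = piPremeasure (fun _ : Fin d => μ.toOuterMeasure) (t k) := by
    intro k
    simp only [measure_toMeasurable]
    rfl
  refine ⟨fun k i => toMeasurable μ (Function.eval i '' t k),
    fun k i => measurableSet_toMeasurable _ _, ?_, ?_⟩
  · intro x hx
    obtain ⟨k, hk⟩ := Set.mem_iUnion.1 (hst hx)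
    exact Set.mem_iUnion.2 ⟨k, fun i _ => subset_toMeasurable _ _ ⟨x, hk, rfl⟩⟩
  · refine le_trans (ENNReal.tsum_le_tsum fun k => ?_) ht.le
    -- The outer measure charges nothing for empty sets; the empty product at `d = 0` would be `1`,
    -- hence `hd`.
    rcases (t k).eq_empty_or_nonempty with h0 | h0
    · refine le_of_eq_of_le (Finset.prod_eq_zero (Finset.mem_univ (⟨0, hd⟩ : Fin d)) ?_) zero_le
      simp [measure_toMeasurable, h0]
    · rw [hpre]
      exact le_iSup (fun _ : (t k).Nonempty =>
        piPremeasure (fun _ : Fin d => μ.toOuterMeasure) (t k)) h0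

/-! ### Cells and their representatives -/

section Cells

variable {E ι : Type*} [MeasurableSpace E] [Fintype ι] {μ : Measure E} [IsProbabilityMeasure μ]
  {c : E → ι} {κ : Type*} [Fintype κ] [DecidableEq κ]

omit [Fintype ι] [DecidableEq κ] in
theorem measurableSet_cellBox (hc : ∀ a, MeasurableSet (c ⁻¹' {a})) (A : κ → ι) :
    MeasurableSet (Set.univ.pi fun j => c ⁻¹' {A j}) :=
  MeasurableSet.univ_pi fun j => hc (A j)

omit [MeasurableSpace E] [Fintype ι] [Fintype κ] [DecidableEq κ] in
theorem mem_cellBox_iff {A : κ → ι} {x : κ → E} :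
    x ∈ Set.univ.pi (fun j => c ⁻¹' {A j}) ↔ c ∘ x = A := by
  simp [funext_iff]

omit [MeasurableSpace E] [Fintype ι] [Fintype κ] [DecidableEq κ] in
theorem pairwise_disjoint_cellBox :
    Pairwise (Function.onFun Disjoint fun A : κ → ι => Set.univ.pi fun j => c ⁻¹' {A j}) := by
  intro A A' hne
  refine Set.disjoint_left.2 fun x hx hx' => hne ?_
  rw [mem_cellBox_iff] at hx hx'
  rw [← hx, ← hx']

omit [Fintype ι] [DecidableEq κ] in
theorem pi_cells_mem_eq_sum (hc : ∀ a, MeasurableSet (c ⁻¹' {a})) (s : Finset (κ → ι)) :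
    (Measure.pi fun _ : κ => μ) {x | c ∘ x ∈ s} = ∑ A ∈ s, ∏ j, μ (c ⁻¹' {A j}) := by
  have h : {x : κ → E | c ∘ x ∈ s} = ⋃ A ∈ s, Set.univ.pi fun j => c ⁻¹' {A j} := by
    ext x
    simp only [Set.mem_iUnion, mem_cellBox_iff, exists_prop]
    exact ⟨fun hx => ⟨_, hx, rfl⟩, fun ⟨A, hA, h⟩ => by rw [← h] at hA; exact hA⟩
  rw [h, measure_biUnion_finset (fun A _ A' _ hne => pairwise_disjoint_cellBox hne)
    fun A _ => measurableSet_cellBox hc A]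
  simp

theorem sum_measure_cells (hc : ∀ a, MeasurableSet (c ⁻¹' {a})) : ∑ a, μ (c ⁻¹' {a}) = 1 := by
  rw [← measure_biUnion_finset (fun a _ a' _ hne =>
    (Set.disjoint_singleton.2 hne).preimage c) fun a _ => hc a]
  have : (⋃ a ∈ (Finset.univ : Finset ι), c ⁻¹' {a}) = Set.univ := by
    ext x; simp
  rw [this, measure_univ]

open Classical in
theorem pi_not_injective_cells_le (hc : ∀ a, MeasurableSet (c ⁻¹' {a})) {δ : ℝ≥0∞}
    (hδ : ∀ a, μ (c ⁻¹' {a}) ≤ δ) :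
    (Measure.pi fun _ : κ => μ) {x | ¬ Function.Injective (c ∘ x)}
      ≤ (Fintype.card κ : ℝ≥0∞) ^ 2 * δ := by
  have hpair : ∀ i j : κ, i ≠ j →
      (Measure.pi fun _ : κ => μ) {x | c (x i) = c (x j)} ≤ δ := by
    intro i j hij
    have hind : iIndepFun (fun (k : κ) (x : κ → E) => x k) (Measure.pi fun _ : κ => μ) :=
      iIndepFun_pi (X := fun _ => id) fun _ => aemeasurable_id
    have heval : ∀ k : κ, ∀ s : Set E, MeasurableSet s →
        (Measure.pi fun _ : κ => μ) ((fun x : κ → E => x k) ⁻¹' s) = μ s := fun k s hs =>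
      (measurePreserving_eval (fun _ : κ => μ) k).measure_preimage hs.nullMeasurableSet
    have h1 : {x : κ → E | c (x i) = c (x j)}
        ⊆ ⋃ a, ((fun x => x i) ⁻¹' (c ⁻¹' {a}) ∩ (fun x => x j) ⁻¹' (c ⁻¹' {a})) := by
      intro x hx
      exact Set.mem_iUnion.2 ⟨c (x j), hx, rfl⟩
    calc _ ≤ ∑ a, (Measure.pi fun _ : κ => μ)
          ((fun x => x i) ⁻¹' (c ⁻¹' {a}) ∩ (fun x => x j) ⁻¹' (c ⁻¹' {a})) :=
          (measure_mono h1).trans (measure_iUnion_fintype_le _ _)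
      _ = ∑ a, μ (c ⁻¹' {a}) * μ (c ⁻¹' {a}) := by
          refine Finset.sum_congr rfl fun a _ => ?_
          rw [(hind.indepFun hij).measure_inter_preimage_eq_mul _ _ (hc a) (hc a),
            heval i _ (hc a), heval j _ (hc a)]
      _ ≤ ∑ a, μ (c ⁻¹' {a}) * δ := by gcongr; exact hδ _
      _ = δ := by rw [← Finset.sum_mul, sum_measure_cells hc, one_mul]
  have h2 : {x : κ → E | ¬ Function.Injective (c ∘ x)}
      ⊆ ⋃ p : κ × κ, {x | p.1 ≠ p.2 ∧ c (x p.1) = c (x p.2)} := by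
    intro x hx
    have hx' : ∃ i j, c (x i) = c (x j) ∧ i ≠ j := by
      simpa [Function.Injective] using hx
    obtain ⟨i, j, hij, hne⟩ := hx'
    exact Set.mem_iUnion.2 ⟨(i, j), hne, hij⟩
  calc _ ≤ ∑ p : κ × κ, (Measure.pi fun _ : κ => μ) {x | p.1 ≠ p.2 ∧ c (x p.1) = c (x p.2)} :=
        (measure_mono h2).trans (measure_iUnion_fintype_le _ _)
    _ ≤ ∑ _p : κ × κ, δ := by
        refine Finset.sum_le_sum fun p _ => ?_
        by_cases hp : p.1 = p.2
        · simp [hp]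
        · exact (measure_mono fun x hx => hx.2).trans (hpair _ _ hp)
    _ = _ := by simp [sq]

open Classical in
theorem one_le_sum_injective_add (hc : ∀ a, MeasurableSet (c ⁻¹' {a})) {δ : ℝ≥0∞}
    (hδ : ∀ a, μ (c ⁻¹' {a}) ≤ δ) :
    1 ≤ ∑ A : κ → ι with Function.Injective A, ∏ j, μ (c ⁻¹' {A j})
      + (Fintype.card κ : ℝ≥0∞) ^ 2 * δ := by
  rw [← pi_cells_mem_eq_sum hc]
  refine le_trans ?_ (add_le_add_right (pi_not_injective_cells_le (κ := κ) hc hδ) _)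
  refine le_trans ?_ (measure_union_le _ _)
  have : {x : κ → E | c ∘ x ∈ Finset.univ.filter fun A : κ → ι => Function.Injective A}
      ∪ {x | ¬ Function.Injective (c ∘ x)} = Set.univ := by
    ext x
    simp [_root_.em]
  rw [this, measure_univ]

omit [DecidableEq κ] in
/-- Choosing one point in each cell, weighted by the cells, reproduces the product measure on every
box with distinct cells. -/
theorem smul_map_pi_eq_restrict {b : ι → ℝ≥0∞} {ν : ι → Measure E}
    [∀ a, IsProbabilityMeasure (ν a)] (hν : ∀ a, b a • ν a = μ.restrict (c ⁻¹' {a}))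
    {A : κ → ι} (hA : Function.Injective A) :
    (∏ j, b (A j)) • (Measure.pi ν).map (fun y j => y (A j))
      = (Measure.pi fun _ : κ => μ).restrict (Set.univ.pi fun j => c ⁻¹' {A j}) := by
  have hind : iIndepFun (fun (a : ι) (y : ι → E) => y a) (Measure.pi ν) :=
    iIndepFun_pi (X := fun _ => id) fun _ => aemeasurable_id
  have hmap : (Measure.pi ν).map (fun y j => y (A j)) = Measure.pi fun j => ν (A j) := by
    rw [(hind.precomp hA).map_fun_eq_pi_map fun j => (measurable_pi_apply _).aemeasurable]
    congr 1
    ext1 j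
    exact (measurePreserving_eval ν (A j)).map_eq
  rw [hmap, Measure.restrict_pi_pi]
  symm
  refine Measure.pi_eq fun s hs => ?_
  simp only [Measure.smul_apply, Measure.pi_pi, smul_eq_mul]
  rw [← Finset.prod_mul_distrib]
  refine Finset.prod_congr rfl fun j _ => ?_
  rw [← hν]
  rfl

open Classical in
theorem sum_injective_lintegral_le {b : ι → ℝ≥0∞} {ν : ι → Measure E}
    [∀ a, IsProbabilityMeasure (ν a)] (hc : ∀ a, MeasurableSet (c ⁻¹' {a}))
    (hν : ∀ a, b a • ν a = μ.restrict (c ⁻¹' {a}))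
    {φ : (κ → E) → ℝ≥0∞} (hφ : Measurable φ) :
    ∑ A : κ → ι with Function.Injective A,
        (∏ j, b (A j)) * ∫⁻ y, φ (fun j => y (A j)) ∂(Measure.pi ν)
      ≤ ∫⁻ x, φ x ∂(Measure.pi fun _ : κ => μ) := by
  calc _ = ∑ A : κ → ι with Function.Injective A,
        ∫⁻ x in Set.univ.pi fun j => c ⁻¹' {A j}, φ x ∂(Measure.pi fun _ : κ => μ) := by
        refine Finset.sum_congr rfl fun A hA => ?_
        rw [← smul_map_pi_eq_restrict hν (Finset.mem_filter.1 hA).2, lintegral_smul_measure,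
          lintegral_map hφ (measurable_pi_lambda _ fun j => measurable_pi_apply _), smul_eq_mul]
    _ = ∫⁻ x in ⋃ A ∈ (Finset.univ.filter fun A : κ → ι => Function.Injective A),
          Set.univ.pi fun j => c ⁻¹' {A j}, φ x ∂(Measure.pi fun _ : κ => μ) := by
        rw [lintegral_biUnion_finset (fun A _ A' _ hne => pairwise_disjoint_cellBox hne)
          fun A _ => measurableSet_cellBox hc A]
    _ ≤ _ := setLIntegral_le_lintegral _ _

omit [Fintype ι] in
theorem exists_smul_eq_restrict (a : ι) :
    ∃ ν : Measure E, IsProbabilityMeasure ν ∧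
      μ (c ⁻¹' {a}) • ν = μ.restrict (c ⁻¹' {a}) := by
  by_cases h : μ (c ⁻¹' {a}) = 0
  -- A negligible cell has weight zero, so any probability measure serves.
  · exact ⟨μ, inferInstance, by rw [h, zero_smul, Measure.restrict_eq_zero.2 h]⟩
  · refine ⟨ProbabilityTheory.cond μ (c ⁻¹' {a}), cond_isProbabilityMeasure h, ?_⟩
    rw [ProbabilityTheory.cond, smul_smul, ENNReal.mul_inv_cancel h (measure_ne_top _ _), one_smul]

open Classical in
/-- There are representatives of the cells along which the average of `φ` is at most its
integral. -/
theorem exists_representatives (hc : ∀ a, MeasurableSet (c ⁻¹' {a}))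
    {φ : (κ → E) → ℝ≥0∞} (hφ : Measurable φ) :
    ∃ y : ι → E, (∀ a, μ (c ⁻¹' {a}) ≠ 0 → c (y a) = a) ∧
      ∑ A : κ → ι with Function.Injective A,
        (∏ j, μ (c ⁻¹' {A j})) * φ (fun j => y (A j))
      ≤ ∫⁻ x, φ x ∂(Measure.pi fun _ : κ => μ) := by
  choose ν hνp hν using exists_smul_eq_restrict (μ := μ) (c := c)
  have hφA : ∀ A : κ → ι, Measurable fun y : ι → E => φ (fun j => y (A j)) := fun A =>
    hφ.comp (measurable_pi_lambda _ fun j => measurable_pi_apply _)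
  have hnull : (Measure.pi ν) {y | ∃ a, μ (c ⁻¹' {a}) ≠ 0 ∧ c (y a) ≠ a} = 0 := by
    have h1 : {y : ι → E | ∃ a, μ (c ⁻¹' {a}) ≠ 0 ∧ c (y a) ≠ a}
        ⊆ ⋃ a, {y | μ (c ⁻¹' {a}) ≠ 0 ∧ c (y a) ≠ a} := by
      rintro y ⟨a, ha⟩
      exact Set.mem_iUnion.2 ⟨a, ha⟩
    refine measure_mono_null h1 (measure_iUnion_null fun a => ?_)
    by_cases ha : μ (c ⁻¹' {a}) = 0
    · simp [ha]
    have h2 : {y : ι → E | μ (c ⁻¹' {a}) ≠ 0 ∧ c (y a) ≠ a}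
        = (fun y => y a) ⁻¹' (c ⁻¹' {a})ᶜ := by
      ext y
      simp [ha]
    have h3 : ν a (c ⁻¹' {a})ᶜ = 0 := by
      have h4 := congrArg (fun m : Measure E => m (c ⁻¹' {a})ᶜ) (hν a)
      simp only [Measure.smul_apply, smul_eq_mul, Measure.restrict_apply (hc a).compl,
        Set.compl_inter_self, measure_empty, mul_eq_zero] at h4
      exact h4.resolve_left ha
    rw [h2, (measurePreserving_eval ν a).measure_preimage (hc a).compl.nullMeasurableSet, h3]
  -- First-moment method: with `y` drawn from the product of the cell laws, the expected weighted
  -- sum is at most `∫⁻ φ`.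
  obtain ⟨y, hy, hle⟩ := exists_notMem_null_le_lintegral (μ := Measure.pi ν)
    (f := fun y => ∑ A : κ → ι with Function.Injective A,
        (∏ j, μ (c ⁻¹' {A j})) * φ (fun j => y (A j)))
    (Finset.measurable_sum _ fun A _ => (hφA A).const_mul _).aemeasurable hnull
  refine ⟨y, ?_, hle.trans ?_⟩
  · intro a ha
    by_contra hne
    exact hy ⟨a, ha, hne⟩
  · rw [lintegral_finsetSum _ fun A _ => (hφA A).const_mul _]
    simp_rw [lintegral_const_mul _ (hφA _)]
    exact sum_injective_lintegral_le hc hν hφ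

end Cells

-- Injectivity is kept only inside the block `k`; the other blocks then factor out, each with total
-- weight at most `1`.
open Classical in
theorem sum_injective_blocks_le {ι : Type*} [Fintype ι] {b : ι → ℝ≥0∞} (hb : ∑ a, b a ≤ 1)
    (L d : ℕ) (f : (Fin d → ι) → ℝ≥0∞) :
    ∑ A : Fin L × Fin d → ι with Function.Injective A,
        (∏ p, b (A p)) * ∑ k, f (fun i => A (k, i))
      ≤ L * ∑ α : Fin d → ι with Function.Injective α, (∏ i, b (α i)) * f α := by
  have hle1 : ∑ α : Fin d → ι, ∏ i, b (α i) ≤ 1 := by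
    have : ∑ α : Fin d → ι, ∏ i, b (α i) = ∏ _i : Fin d, ∑ a, b a := by
      rw [Finset.prod_univ_sum]; simp
    rw [this]
    exact Finset.prod_le_one' fun _ _ => hb
  have hblock : ∀ k : Fin L, ∑ A : Fin L × Fin d → ι with Function.Injective A,
      (∏ p, b (A p)) * f (fun i => A (k, i))
        ≤ ∑ α : Fin d → ι with Function.Injective α, (∏ i, b (α i)) * f α := by
    intro k
    let ψ : Fin L → (Fin d → ι) → ℝ≥0∞ := fun k' α =>
      if k' = k then (if Function.Injective α then (∏ i, b (α i)) * f α else 0)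
      else ∏ i, b (α i)
    calc _ ≤ ∑ A : Fin L × Fin d → ι, ∏ k', ψ k' (fun i => A (k', i)) := by
          rw [Finset.sum_filter]
          refine Finset.sum_le_sum fun A _ => ?_
          split_ifs with hA
          · rw [Fintype.prod_prod_type, ← Finset.mul_prod_erase Finset.univ
              (fun k' => ∏ i, b (A (k', i))) (Finset.mem_univ k),
              ← Finset.mul_prod_erase Finset.univ
              (fun k' => ψ k' (fun i => A (k', i))) (Finset.mem_univ k)]
            have hinj : Function.Injective fun i => A (k, i) := fun i j hij => by
              simpa using hA hij
            have h1 : ψ k (fun i => A (k, i)) = (∏ i, b (A (k, i))) * f (fun i => A (k, i)) := by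
              simp [ψ, hinj]
            have h2 : ∏ k' ∈ Finset.univ.erase k, ψ k' (fun i => A (k', i))
                = ∏ k' ∈ Finset.univ.erase k, ∏ i, b (A (k', i)) := by
              refine Finset.prod_congr rfl fun k' hk' => ?_
              simp [ψ, Finset.ne_of_mem_erase hk']
            rw [h1, h2]
            refine le_of_eq ?_
            ring
          · exact zero_le
      _ = ∑ B : Fin L → Fin d → ι, ∏ k', ψ k' (B k') :=
          Equiv.sum_comp (Equiv.curry (Fin L) (Fin d) ι) fun B => ∏ k', ψ k' (B k')
      _ = ∏ k', ∑ α, ψ k' α := by rw [Finset.prod_univ_sum]; simp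
      _ ≤ ∑ α, ψ k α := by
          rw [← Finset.mul_prod_erase Finset.univ (fun k' => ∑ α, ψ k' α) (Finset.mem_univ k)]
          refine mul_le_of_le_one_right zero_le (Finset.prod_le_one' fun k' hk' => ?_)
          simpa [ψ, Finset.ne_of_mem_erase hk'] using hle1
      _ = _ := by simp [ψ, Finset.sum_filter]
  simp_rw [Finset.mul_sum]
  rw [Finset.sum_comm]
  refine (Finset.sum_le_sum fun k _ => hblock k).trans ?_
  simp [Finset.mul_sum]

/-! ### The process on the cells -/

section CellProcess

variable {E ι : Type*} {d : ℕ}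

/-- The supremum over `t ∈ T` of the sums of `t` over the points `y a`, `a ∈ W`. -/
noncomputable def cellSup (T : Set (E → ℝ≥0)) (y : ι → E) (W : Finset ι) : ℝ≥0∞ :=
  ⨆ t ∈ T, ∑ a ∈ W, (t (y a) : ℝ≥0∞)

open Classical in
/-- The set of the first `l` values of a finite sequence. -/
noncomputable def initialValues (A : Fin d → ι) (l : ℕ) : Finset ι :=
  (Finset.univ.filter fun i : Fin d => (i : ℕ) < l).image A

open Classical in
theorem monotone_initialValues (A : Fin d → ι) : Monotone (initialValues A) := by
  intro l l' h
  refine Finset.image_subset_image fun i hi => ?_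
  simp only [Finset.mem_filter, Finset.mem_univ, true_and] at hi ⊢
  omega

open Classical in
theorem card_initialValues_le (A : Fin d → ι) (l : ℕ) : (initialValues A l).card ≤ l := by
  refine Finset.card_image_le.trans ?_
  rw [Fin.card_filter_val_lt]
  exact min_le_right _ _

open Classical in
theorem initialValues_self (A : Fin d → ι) : initialValues A d = Finset.univ.image A := by
  unfold initialValues
  rw [Finset.filter_true_of_mem fun i _ => i.2]

/-- The families of distinct non-negligible cells, listed with decreasing weights for some `t ∈ T`,
whose total weight exceeds `s`. -/
def heavyFamilies (d : ℕ) (T : Set (E → ℝ≥0)) (y : ι → E) (b : ι → ℝ≥0∞) (s : ℝ≥0∞) :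
    Set (Fin d → ι) :=
  {A | Function.Injective A ∧ (∀ i, b (A i) ≠ 0) ∧
    ∃ t ∈ T, Antitone (fun i => t (y (A i))) ∧ s < ∑ i, (t (y (A i)) : ℝ≥0∞)}

-- Capture at all scales bounds the missing indices in each initial segment of the decreasing list,
-- so Abel summation leaves half of the sum on `W`.
open Classical in
theorem lt_two_mul_cellSup_of_captured {T : Set (E → ℝ≥0)} {y : ι → E}
    {b : ι → ℝ≥0∞} {s : ℝ≥0∞} {W : Finset ι} {A : Fin d → ι}
    (hA : A ∈ heavyFamilies d T y b s)
    (hW : Captured initialValues d 0 W A) : s < 2 * cellSup T y W := by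
  obtain ⟨hinj, -, t, ht, hanti, hs⟩ := hA
  let I : Finset (Fin d) := Finset.univ.filter fun i => A i ∈ W
  have hI : ∀ l ≤ d, 2 * (Finset.univ.filter fun i : Fin d => (i : ℕ) < l ∧ i ∉ I).card ≤ l := by
    intro l hl
    rcases Nat.eq_zero_or_pos l with rfl | hl0
    · simp
    refine le_trans (Nat.mul_le_mul_left _ ?_) (hW l hl0 hl)
    rw [← Finset.card_image_of_injective _ hinj]
    refine Finset.card_le_card fun a ha => ?_
    obtain ⟨i, hi, rfl⟩ := Finset.mem_image.1 ha
    simp only [Finset.mem_filter, Finset.mem_univ, true_and, I] at hi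
    refine Finset.mem_sdiff.2 ⟨?_, hi.2⟩
    unfold initialValues
    exact Finset.mem_image.2 ⟨i, by simpa using hi.1, rfl⟩
  have h1 := sum_le_two_mul_sum_of_antitone hanti I hI
  have h2 : ∑ i, (t (y (A i)) : ℝ≥0∞) ≤ 2 * ∑ i ∈ I, (t (y (A i)) : ℝ≥0∞) := by exact_mod_cast h1
  have h3 : ∑ i ∈ I, (t (y (A i)) : ℝ≥0∞) ≤ ∑ a ∈ W, (t (y a) : ℝ≥0∞) := by
    rw [← Finset.sum_image (f := fun a => (t (y a) : ℝ≥0∞)) fun i _ j _ hij => hinj hij]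
    refine Finset.sum_le_sum_of_subset fun a ha => ?_
    obtain ⟨i, hi, rfl⟩ := Finset.mem_image.1 ha
    simpa [I] using hi
  have h4 : ∑ a ∈ W, (t (y a) : ℝ≥0∞) ≤ cellSup T y W :=
    le_iSup₂ (f := fun (t : E → ℝ≥0) (_ : t ∈ T) => ∑ a ∈ W, (t (y a) : ℝ≥0∞)) t ht
  calc s < _ := hs
    _ ≤ _ := h2
    _ ≤ _ := by gcongr; exact h3.trans h4

open Classical in
theorem exists_heavyFamily {T : Set (E → ℝ≥0)} {y : ι → E} {b : ι → ℝ≥0∞} {s : ℝ≥0∞}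
    {α : Fin d → ι} (hinj : Function.Injective α) (hb : ∀ i, b (α i) ≠ 0)
    (hs : s < supSum T fun i => y (α i)) :
    ∃ A ∈ heavyFamilies d T y b s, initialValues A d = Finset.univ.image α := by
  unfold supSum at hs
  obtain ⟨t, hs⟩ := lt_iSup_iff.1 hs
  obtain ⟨ht, hs⟩ := lt_iSup_iff.1 hs
  -- The dual order makes sorting list the values decreasingly.
  let w : Fin d → ℝ≥0ᵒᵈ := fun i => OrderDual.toDual (t (y (α i)))
  let σ := Tuple.sort w
  refine ⟨α ∘ σ, ⟨hinj.comp σ.injective, fun i => hb _, t, ht, ?_, ?_⟩, ?_⟩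
  · intro i j hij
    exact Tuple.monotone_sort w hij
  · exact hs.trans_eq (Equiv.sum_comp σ fun i => (t (y (α i)) : ℝ≥0∞)).symm
  · rw [initialValues_self]
    ext a
    simp only [Finset.mem_image, Finset.mem_univ, true_and, Function.comp_apply]
    exact ⟨fun ⟨i, hi⟩ => ⟨σ i, hi⟩, fun ⟨i, hi⟩ => ⟨σ.symm i, by simpa using hi⟩⟩

open Classical in
theorem cellSup_image_le {L : ℕ} (T : Set (E → ℝ≥0)) (y : ι → E) (A : Fin L × Fin d → ι) :
    cellSup T y (Finset.univ.image A) ≤ ∑ k, supSum T fun i => y (A (k, i)) := by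
  refine iSup₂_le fun t ht => ?_
  calc _ ≤ ∑ p, (t (y (A p)) : ℝ≥0∞) := by
        rw [← Finset.sum_fiberwise_of_maps_to (s := Finset.univ) (t := Finset.univ.image A)
          (g := A) fun p _ => Finset.mem_image_of_mem A (Finset.mem_univ p)]
        refine Finset.sum_le_sum fun a ha => ?_
        obtain ⟨p, hp, rfl⟩ := Finset.mem_image.1 ha
        exact Finset.single_le_sum (f := fun p => (t (y (A p)) : ℝ≥0∞)) (fun _ _ => zero_le)
          (Finset.mem_filter.2 ⟨hp, rfl⟩)
    _ = ∑ k, ∑ i, (t (y (A (k, i))) : ℝ≥0∞) := Fintype.sum_prod_type _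
    _ ≤ _ := Finset.sum_le_sum fun k _ =>
        le_iSup₂ (f := fun (t : E → ℝ≥0) (_ : t ∈ T) => ∑ i, (t (y (A (k, i))) : ℝ≥0∞)) t ht

open Classical in
/-- Some finite set of cells captures no heavy family and has fragments of small total cost. -/
theorem exists_uncaptured_fragmentCost_le [Fintype ι] {T : Set (E → ℝ≥0)} {y : ι → E}
    {b : ι → ℝ≥0∞} (hb : ∑ a, b a ≤ 1) {S : ℝ≥0∞} (hS0 : S ≠ 0) (hS : S ≠ ∞)
    (hmean : ∑ α : Fin d → ι with Function.Injective α,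
      (∏ i, b (α i)) * supSum T (fun i => y (α i)) ≤ 2 * S)
    {L : ℕ} (hL : L = 768)
    (hinj : 1 ≤ ∑ A : Fin L × Fin d → ι with Function.Injective A, ∏ p, b (A p) + 1 / 8) :
    ∃ W : Finset ι,
      (∀ A ∈ heavyFamilies d T y b (24576 * S), ¬ Captured initialValues d 0 W A) ∧
      fragmentCost (heavyFamilies d T y b (24576 * S)) initialValues d b (3 * d) W ≤ 1 / 4 := by
  set H := heavyFamilies d T y b (24576 * S)
  let J : Finset (Fin L × Fin d → ι) := Finset.univ.filter fun A => Function.Injective A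
  let bad : (Fin L × Fin d → ι) → Prop := fun A =>
    24576 * S < 2 * cellSup T y (Finset.univ.image A)
  have hbad : ∑ A ∈ J.filter bad, ∏ p, b (A p) ≤ 1 / 8 := by
    -- Markov's inequality: `2 * 768 * 2 = 3072`, which is one eighth of `24576`.
    have h1 : 24576 * S * ∑ A ∈ J.filter bad, ∏ p, b (A p) ≤ 2 * (768 * (2 * S)) := by
      calc _ = ∑ A ∈ J.filter bad, (∏ p, b (A p)) * (24576 * S) := by
            rw [mul_comm, Finset.sum_mul]
        _ ≤ ∑ A ∈ J.filter bad, (∏ p, b (A p)) * (2 * ∑ k, supSum T fun i => y (A (k, i))) := by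
            refine Finset.sum_le_sum fun A hA => mul_le_mul_right ?_ _
            refine (Finset.mem_filter.1 hA).2.le.trans ?_
            gcongr
            exact cellSup_image_le T y A
        _ ≤ ∑ A ∈ J, (∏ p, b (A p)) * (2 * ∑ k, supSum T fun i => y (A (k, i))) :=
            Finset.sum_le_sum_of_subset (Finset.filter_subset _ _)
        _ = 2 * ∑ A ∈ J, (∏ p, b (A p)) * ∑ k, supSum T fun i => y (A (k, i)) := by
            rw [Finset.mul_sum]
            exact Finset.sum_congr rfl fun A _ => mul_left_comm _ _ _
        _ ≤ 2 * (768 * (2 * S)) := by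
            gcongr
            refine (sum_injective_blocks_le hb L d fun α => supSum T fun i => y (α i)).trans ?_
            rw [hL]
            push_cast
            gcongr
    have h2 : (24576 * S)⁻¹ * (24576 * S) = 1 :=
      ENNReal.inv_mul_cancel (by simp [hS0]) (by simp [ENNReal.mul_eq_top, hS])
    calc _ = (24576 * S)⁻¹ * (24576 * S * ∑ A ∈ J.filter bad, ∏ p, b (A p)) := by
          rw [← mul_assoc, h2, one_mul]
      _ ≤ (24576 * S)⁻¹ * (2 * (768 * (2 * S))) := by gcongr
      _ = (24576 * S)⁻¹ * (24576 * S) * (1 / 8) := by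
          rw [mul_assoc]
          congr 1
          have : (24576 : ℝ≥0∞) * (1 / 8) = 3072 := by
            rw [show (24576 : ℝ≥0∞) = 3072 * 8 by norm_num, one_div, mul_assoc,
              ENNReal.mul_inv_cancel (by norm_num) (by norm_num), mul_one]
          calc _ = 3072 * S := by ring
            _ = 24576 * (1 / 8) * S := by rw [this]
            _ = _ := by ring
      _ = 1 / 8 := by rw [h2, one_mul]
  have hcost : ∑ A ∈ J, (∏ p, b (A p)) *
      fragmentCost H initialValues d b (3 * d) (Finset.univ.image A) ≤ 1 / 8 := by
    have h1 := sum_injective_eq_factorial_mul (κ := Fin L × Fin d) b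
      (fragmentCost H initialValues d b (3 * d))
    have hc : Fintype.card (Fin L × Fin d) = 768 * d := by simp [hL]
    rw [hc] at h1
    refine h1.trans_le ?_
    exact sum_fragmentCost_le (H := H) monotone_initialValues card_initialValues_le d b hb
  -- Injective samples that are not bad have weight at least `3 / 4`; if all of them cost more than
  -- `1 / 4`, `hcost` would limit that weight to `1 / 2`.
  have hgood : ∃ A ∈ J, ¬ bad A ∧
      fragmentCost H initialValues d b (3 * d) (Finset.univ.image A) ≤ 1 / 4 := by
    by_contra! hcon
    have h1 : (1 / 4 : ℝ≥0∞) * ∑ A ∈ J.filter (fun A => ¬ bad A), ∏ p, b (A p) ≤ 1 / 8 := by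
      refine le_trans ?_ hcost
      rw [Finset.mul_sum]
      refine le_trans ?_ (Finset.sum_le_sum_of_subset (Finset.filter_subset (fun A => ¬ bad A) J))
      refine Finset.sum_le_sum fun A hA => ?_
      rw [mul_comm]
      have hA' := Finset.mem_filter.1 hA
      exact mul_le_mul_right (hcon A hA'.1 hA'.2).le _
    have h2 := Finset.sum_filter_add_sum_filter_not J bad fun A => ∏ p, b (A p)
    have h3 : (1 : ℝ≥0∞) ≤ 1 / 8 + ∑ A ∈ J.filter (fun A => ¬ bad A), ∏ p, b (A p) + 1 / 8 := by
      refine hinj.trans ?_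
      rw [← h2]
      gcongr
    set x := ∑ A ∈ J.filter (fun A => ¬ bad A), ∏ p, b (A p)
    clear_value x
    rcases eq_or_ne x ∞ with hx | hx
    · rw [hx, ENNReal.mul_top (by simp)] at h1
      simp at h1
    · lift x to ℝ≥0 using hx
      have h1' : (1 / 4 : ℝ) * x ≤ 1 / 8 := by
        have := ENNReal.toReal_mono (by simp) h1
        simpa using this
      have h3' : (1 : ℝ) ≤ 1 / 8 + x + 1 / 8 := by
        have := ENNReal.toReal_mono (by simp [ENNReal.add_eq_top]) h3
        rw [ENNReal.toReal_add (by simp [ENNReal.add_eq_top]) (by simp),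
          ENNReal.toReal_add (by simp) (by simp)] at this
        simpa using this
      linarith
  obtain ⟨A, -, hA, hAc⟩ := hgood
  exact ⟨Finset.univ.image A, fun B hB hcap => hA (lt_two_mul_cellSup_of_captured hB hcap), hAc⟩

end CellProcess

/-! ### Half-spaces containing rectangles and cell events -/

section CoveringHalfSpaces

variable {E : Type*} {d : ℕ}

/-- The points of `E ^ d` at which the empirical mean of `q.1` is at least `q.2`. -/
def empiricalHalfSpace (d : ℕ) (q : (E → ℝ≥0) × ℝ≥0) : Set (Fin d → E) :=
  {x | q.2 ≤ (1 / (d : ℝ≥0)) * ∑ i, q.1 (x i)}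

theorem measurableSet_empiricalHalfSpace [MeasurableSpace E] {q : (E → ℝ≥0) × ℝ≥0}
    (hq : Measurable q.1) : MeasurableSet (empiricalHalfSpace d q) :=
  measurableSet_le measurable_const
    ((Finset.measurable_sum _ fun i _ => hq.comp (measurable_pi_apply i)).const_mul _)

theorem mem_empiricalHalfSpace_scaled_iff (hd : 0 < d) {g : E → ℝ≥0} {s : ℝ≥0} {x : Fin d → E} :
    x ∈ empiricalHalfSpace d (g, (1 / (d : ℝ≥0)) * s) ↔ s ≤ ∑ i, g (x i) := by
  have : (0 : ℝ≥0) < 1 / (d : ℝ≥0) := by positivity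
  exact mul_le_mul_iff_right₀ this

variable [MeasurableSpace E] {μ : Measure E} [IsProbabilityMeasure μ]

/-- A rectangle is covered by a half-space of comparable measure. -/
theorem exists_halfSpace_rectangle_subset (hd : 0 < d) {C : Fin d → Set E}
    (hC : ∀ i, MeasurableSet (C i)) :
    ∃ q : (E → ℝ≥0) × ℝ≥0, Measurable q.1 ∧ Set.univ.pi C ⊆ empiricalHalfSpace d q ∧
      (Measure.pi fun _ : Fin d => μ) (empiricalHalfSpace d q)
        ≤ (1 + d : ℝ≥0∞) ^ d * ∏ i, μ (C i) := by
  classical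
  by_cases h0 : ∃ i, μ (C i) = 0
  · obtain ⟨i, hi⟩ := h0
    refine ⟨((C i).indicator fun _ => 1, (1 / (d : ℝ≥0)) * 1),
      measurable_const.indicator (hC i), ?_, ?_⟩
    · intro x hx
      rw [mem_empiricalHalfSpace_scaled_iff hd]
      refine le_trans ?_ (Finset.single_le_sum (fun _ _ => zero_le) (Finset.mem_univ i))
      rw [Set.indicator_of_mem (hx i (Set.mem_univ i))]
    · refine le_of_eq_of_le (measure_mono_null (t := ⋃ j : Fin d, (fun x => x j) ⁻¹' C i) ?_ ?_)
        zero_le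
      · intro x hx
        rw [mem_empiricalHalfSpace_scaled_iff hd] at hx
        by_contra hno
        simp only [Set.mem_iUnion, Set.mem_preimage, not_exists] at hno
        rw [Finset.sum_eq_zero fun j _ => Set.indicator_of_notMem (hno j) _] at hx
        exact absurd hx (by norm_num)
      · refine measure_iUnion_null fun j => ?_
        rw [(measurePreserving_eval (fun _ : Fin d => μ) j).measure_preimage
          (hC i).nullMeasurableSet, hi]
  · push Not at h0
    -- This choice makes the Chernoff product equal the measure of the rectangle, at the price of
    -- the factor `(1 + d) ^ d`.
    let r : Fin d → ℝ≥0 := fun i => ((μ (C i))⁻¹).toNNReal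
    have hr : ∀ i, (r i : ℝ≥0∞) = (μ (C i))⁻¹ := fun i =>
      ENNReal.coe_toNNReal (ENNReal.inv_ne_top.2 (h0 i))
    have hr1 : ∀ i ∈ Finset.univ, 1 ≤ r i := by
      intro i _
      rw [← ENNReal.coe_le_coe, hr, ENNReal.coe_one, ENNReal.one_le_inv]
      exact prob_le_one
    refine ⟨(logWeight Finset.univ C r,
      (1 / (d : ℝ≥0)) * ∑ i, (Real.log (r i)).toNNReal),
      measurable_logWeight Finset.univ (fun i _ => hC i) r, ?_, ?_⟩
    · intro x hx
      rw [mem_empiricalHalfSpace_scaled_iff hd]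
      exact sum_log_le_sum_logWeight id (Set.injOn_id _) fun i _ => hx i (Set.mem_univ i)
    · refine le_trans (measure_mono fun x hx => ?_)
        ((pi_halfspace_logWeight_le d Finset.univ (fun i _ => hC i) hr1).trans_eq ?_)
      · exact (mem_empiricalHalfSpace_scaled_iff hd).1 hx
      · congr 1
        · simp only [hr]
          rw [Finset.sum_congr rfl fun i _ =>
            ENNReal.mul_inv_cancel (h0 i) (measure_ne_top _ _)]
          simp
        · simp [hr]

/-- A finite set of small cells has a half-space of small measure containing all points which meet
each of these cells. -/
theorem exists_halfSpace_cells {ι : Type*} {c : E → ι} (hd : 0 < d) (U : Finset ι)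
    (hc : ∀ a, MeasurableSet (c ⁻¹' {a})) (h0 : ∀ a ∈ U, μ (c ⁻¹' {a}) ≠ 0)
    (h1 : ∀ a ∈ U, d * μ (c ⁻¹' {a}) ≤ 1) :
    ∃ q : (E → ℝ≥0) × ℝ≥0, Measurable q.1 ∧
      (∀ x : Fin d → E, (∀ a ∈ U, ∃ j, c (x j) = a) → x ∈ empiricalHalfSpace d q) ∧
      (Measure.pi fun _ : Fin d => μ) (empiricalHalfSpace d q)
        ≤ (3 * d : ℝ≥0∞) ^ U.card * ∏ a ∈ U, μ (c ⁻¹' {a}) := by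
  classical
  have hdE : (d : ℝ≥0∞) ≠ 0 := by exact_mod_cast hd.ne'
  let C : ι → Set E := fun a => c ⁻¹' {a}
  -- The extra factor `d` makes the exponential moment `(1 + U.card / d) ^ d ≤ 3 ^ U.card`; `h1`
  -- ensures `1 ≤ r a`.
  let r : ι → ℝ≥0 := fun a => ((d * μ (C a))⁻¹).toNNReal
  have hr : ∀ a ∈ U, (r a : ℝ≥0∞) = (d * μ (C a))⁻¹ := fun a ha =>
    ENNReal.coe_toNNReal (ENNReal.inv_ne_top.2 (mul_ne_zero hdE (h0 a ha)))
  have hr1 : ∀ a ∈ U, 1 ≤ r a := by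
    intro a ha
    rw [← ENNReal.coe_le_coe, hr a ha, ENNReal.coe_one, ENNReal.one_le_inv]
    exact h1 a ha
  refine ⟨(logWeight U C r, (1 / (d : ℝ≥0)) * ∑ a ∈ U, (Real.log (r a)).toNNReal),
    measurable_logWeight _ (fun a _ => hc a) r, ?_, ?_⟩
  · intro x hx
    rw [mem_empiricalHalfSpace_scaled_iff hd]
    have : Nonempty (Fin d) := ⟨⟨0, hd⟩⟩
    choose! φ hφ using hx
    refine sum_log_le_sum_logWeight φ ?_ fun a ha => hφ a ha
    intro a ha a' ha' h
    rw [← hφ a ha, ← hφ a' ha', h]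
  · refine le_trans (measure_mono fun x hx => ?_)
      ((pi_halfspace_logWeight_le d U (fun a _ => hc a) hr1).trans ?_)
    · exact (mem_empiricalHalfSpace_scaled_iff hd).1 hx
    · have hprod : ∏ a ∈ U, (r a : ℝ≥0∞)⁻¹ = (d : ℝ≥0∞) ^ U.card * ∏ a ∈ U, μ (C a) := by
        rw [Finset.prod_congr rfl fun a ha => by rw [hr a ha, inv_inv], Finset.prod_mul_distrib,
          Finset.prod_const]
      have hsum : ∑ a ∈ U, μ (C a) * r a = U.card * (d : ℝ≥0∞)⁻¹ := by
        rw [← nsmul_eq_mul, ← Finset.sum_const]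
        refine Finset.sum_congr rfl fun a ha => ?_
        rw [hr a ha, ENNReal.mul_inv (Or.inl hdE) (Or.inl (ENNReal.natCast_ne_top d)),
          mul_left_comm, ENNReal.mul_inv_cancel (h0 a ha) (measure_ne_top _ _), mul_one]
      have hexp : (1 + U.card * (d : ℝ≥0∞)⁻¹) ^ d ≤ 3 ^ U.card := by
        have hd' : (0 : ℝ) < d := by exact_mod_cast hd
        have h2 : (1 + (U.card : ℝ) * (d : ℝ)⁻¹) ^ d ≤ 3 ^ U.card := by
          calc _ ≤ (Real.exp (U.card * (d : ℝ)⁻¹)) ^ d := by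
                refine pow_le_pow_left₀ (by positivity) ?_ d
                rw [add_comm]
                exact Real.add_one_le_exp _
            _ = Real.exp 1 ^ U.card := by
                rw [← Real.exp_nat_mul, ← Real.exp_nat_mul]
                congr 1
                field_simp
            _ ≤ 3 ^ U.card := pow_le_pow_left₀ (Real.exp_pos _).le Real.exp_one_lt_three.le _
        have h3 : (1 + (U.card : ℝ≥0) * (d : ℝ≥0)⁻¹) ^ d ≤ 3 ^ U.card := by exact_mod_cast h2
        have h4 : (((1 + (U.card : ℝ≥0) * (d : ℝ≥0)⁻¹) ^ d : ℝ≥0) : ℝ≥0∞)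
            ≤ ((3 ^ U.card : ℝ≥0) : ℝ≥0∞) := by exact_mod_cast h3
        rw [ENNReal.coe_pow, ENNReal.coe_add, ENNReal.coe_mul, ENNReal.coe_inv
          (by exact_mod_cast hd.ne')] at h4
        simpa using h4
      rw [hprod, hsum, mul_pow, mul_assoc]
      gcongr

/-- A set of small outer measure is covered by countably many half-spaces of small total measure. -/
theorem exists_halfSpace_cover (hd : 0 < d) (s : Set (Fin d → E)) {ε : ℝ≥0∞} (hε : ε ≠ 0) :
    ∃ q : ℕ → (E → ℝ≥0) × ℝ≥0, (∀ k, Measurable (q k).1) ∧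
      s ⊆ ⋃ k, empiricalHalfSpace d (q k) ∧
      ∑' k, (Measure.pi fun _ : Fin d => μ) (empiricalHalfSpace d (q k))
        ≤ (1 + d : ℝ≥0∞) ^ d * ((Measure.pi fun _ : Fin d => μ) s + ε) := by
  obtain ⟨B, hB, hs, hsum⟩ := exists_rectangle_cover μ hd s (measure_ne_top _ _) hε
  choose q hq hsub hle using fun k => exists_halfSpace_rectangle_subset (μ := μ) hd (hB k)
  refine ⟨q, hq, hs.trans (Set.iUnion_mono hsub), ?_⟩
  calc _ ≤ ∑' k, (1 + d : ℝ≥0∞) ^ d * ∏ i, μ (B k i) := ENNReal.tsum_le_tsum hle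
    _ = (1 + d : ℝ≥0∞) ^ d * ∑' k, ∏ i, μ (B k i) := ENNReal.tsum_mul_left
    _ ≤ _ := by gcongr

end CoveringHalfSpaces

/-! ### Approximation by rectangles and cells -/

section Approximation

variable {E : Type*} [MeasurableSpace E] {μ : Measure E}

/-- Finitely many measurable sets can be resolved by a partition into small cells. -/
theorem HasNoAtoms.exists_cells_resolving [IsFiniteMeasure μ] (h : HasNoAtoms μ) {δ : ℝ≥0∞}
    (hδ : δ ≠ 0) {N d : ℕ} {B : Fin N → Fin d → Set E} (hB : ∀ k i, MeasurableSet (B k i)) :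
    ∃ (ι : Type) (_ : Fintype ι) (c : E → ι), (∀ a, MeasurableSet (c ⁻¹' {a})) ∧
      (∀ a, μ (c ⁻¹' {a}) ≤ δ) ∧ ∀ k i x x', c x = c x' → x ∈ B k i → x' ∈ B k i := by
  classical
  obtain ⟨n, c₀, hc₀, hδ₀⟩ := h.exists_measurable_fin_measure_le hδ
  refine ⟨Fin n × (Fin N → Fin d → Prop), inferInstance,
    fun x => (c₀ x, fun k i => x ∈ B k i), ?_, ?_, ?_⟩
  · rintro ⟨a, p⟩
    have heq : (fun x => (c₀ x, fun k i => x ∈ B k i)) ⁻¹' {(a, p)}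
        = c₀ ⁻¹' {a} ∩ ⋂ k, ⋂ i, {x | x ∈ B k i ↔ p k i} := by
      ext x
      simp [funext_iff]
    rw [heq]
    refine (hc₀ (measurableSet_singleton a)).inter
      (MeasurableSet.iInter fun k => MeasurableSet.iInter fun i => ?_)
    by_cases hp : p k i
    · simpa [hp] using hB k i
    · simp only [hp, iff_false]
      exact (hB k i).compl
  · rintro ⟨a, p⟩
    refine (measure_mono fun x hx => ?_).trans (hδ₀ a)
    exact congrArg Prod.fst hx
  · intro k i x x' hxx' hx
    have h1 := congrFun (congrFun (congrArg Prod.snd hxx') k) i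
    exact h1.mp hx

/-- Measurable sets of a product are approximated by finite unions of rectangles. -/
theorem exists_finite_rectangles_approx [IsProbabilityMeasure μ] {d : ℕ} (hd : 0 < d)
    {G : Set (Fin d → E)} (hG : MeasurableSet G) {η : ℝ≥0∞} (hη : η ≠ 0) (hη' : η ≠ ∞) :
    ∃ (N : ℕ) (B : Fin N → Fin d → Set E), (∀ k i, MeasurableSet (B k i)) ∧
      (Measure.pi fun _ : Fin d => μ) (G \ ⋃ k, Set.univ.pi (B k)) ≤ η ∧
      (Measure.pi fun _ : Fin d => μ) ((⋃ k, Set.univ.pi (B k)) \ G) ≤ η := by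
  obtain ⟨B, hB, hs, hsum⟩ := exists_rectangle_cover μ hd G (measure_ne_top _ _) hη
  have hfin : ∑' k, ∏ i, μ (B k i) ≠ ∞ :=
    ne_top_of_le_ne_top (ENNReal.add_ne_top.2 ⟨measure_ne_top _ _, hη'⟩) hsum
  obtain ⟨N, hN⟩ := ((ENNReal.tendsto_sum_nat_add _ hfin).eventually
    (gt_mem_nhds (pos_iff_ne_zero.2 hη))).exists
  refine ⟨N, fun k => B k, fun k i => hB k i, ?_, ?_⟩
  · have hsub : G \ ⋃ k : Fin N, Set.univ.pi (B k) ⊆ ⋃ k, Set.univ.pi (B (k + N)) := by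
      rintro x ⟨hxG, hx⟩
      obtain ⟨k, hk⟩ := Set.mem_iUnion.1 (hs hxG)
      have hkN : N ≤ k := by
        by_contra hlt
        exact hx (Set.mem_iUnion.2 ⟨⟨k, not_le.1 hlt⟩, hk⟩)
      refine Set.mem_iUnion.2 ⟨k - N, ?_⟩
      rwa [Nat.sub_add_cancel hkN]
    refine (measure_mono hsub).trans ((measure_iUnion_le _).trans ?_)
    simp only [Measure.pi_pi]
    exact hN.le
  · have hsub : (⋃ k : Fin N, Set.univ.pi (B k)) \ G ⊆ (⋃ k, Set.univ.pi (B k)) \ G :=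
      Set.sdiff_subset_sdiff_left (Set.iUnion_subset fun k =>
        Set.subset_iUnion (fun k => Set.univ.pi (B k)) (k : ℕ))
    refine (measure_mono hsub).trans ?_
    rw [measure_sdiff hs hG.nullMeasurableSet (measure_ne_top _ _), tsub_le_iff_left]
    refine ((measure_iUnion_le _).trans ?_).trans hsum
    simp only [Measure.pi_pi]
    exact le_rfl

end Approximation

/-! ### Discretisation and assembly -/

section Main

variable {E : Type*} [MeasurableSpace E] {μ : Measure E} [IsProbabilityMeasure μ] {d : ℕ}

open Classical in
/-- Points of the cells can be chosen such that the process restricted to them keeps its mean up to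
a factor two and outside a small set every large value is inherited by the chosen points. -/
theorem exists_cells_representatives (hμ : HasNoAtoms μ) (hd : 0 < d) {f : (Fin d → E) → ℝ≥0∞}
    (hf : AEMeasurable f (Measure.pi fun _ : Fin d => μ)) {S : ℝ≥0∞}
    (hS : ∫⁻ x, f x ∂(Measure.pi fun _ : Fin d => μ) = S) (hS0 : S ≠ 0) (hSt : S ≠ ∞)
    (K : ℝ≥0∞) {η δ : ℝ≥0∞} (hη : η ≠ 0) (hη' : η ≠ ∞) (hδ : δ ≠ 0)
    (hδη : (d : ℝ≥0∞) ^ 2 * δ ≤ η) :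
    ∃ (ι : Type) (_ : Fintype ι) (c : E → ι) (y : ι → E),
      (∀ a, MeasurableSet (c ⁻¹' {a})) ∧ (∀ a, μ (c ⁻¹' {a}) ≤ δ) ∧
      ∑ A : Fin d → ι with Function.Injective A,
        (∏ j, μ (c ⁻¹' {A j})) * f (fun j => y (A j)) ≤ 2 * S ∧
      (Measure.pi fun _ : Fin d => μ) {x | K ≤ f x ∧ ¬ (Function.Injective (c ∘ x) ∧
        (∀ j, μ (c ⁻¹' {c (x j)}) ≠ 0) ∧ K ≤ f fun j => y (c (x j)))} ≤ 4 * η := by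
  set π := Measure.pi fun _ : Fin d => μ with hπ
  let f' := hf.mk f
  have hf' : Measurable f' := hf.measurable_mk
  let N₀ : Set (Fin d → E) := toMeasurable π {x | f x ≠ f' x}
  have hN₀ : MeasurableSet N₀ := measurableSet_toMeasurable _ _
  have hN₀0 : π N₀ = 0 := by
    rw [measure_toMeasurable]
    exact hf.ae_eq_mk
  have hN₀f : ∀ x, x ∉ N₀ → f x = f' x := by
    intro x hx
    by_contra hne
    exact hx (subset_toMeasurable _ _ hne)
  let G : Set (Fin d → E) := {x | K ≤ f' x}
  have hG : MeasurableSet G := measurableSet_le measurable_const hf'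
  obtain ⟨N, B, hB, hB1, hB2⟩ := exists_finite_rectangles_approx (μ := μ) hd hG hη hη'
  obtain ⟨ι, hι, c, hc, hcδ, hcB⟩ := hμ.exists_cells_resolving hδ hB
  let GN : Set (Fin d → E) := ⋃ k, Set.univ.pi (B k)
  have hGN : MeasurableSet GN := MeasurableSet.iUnion fun k => MeasurableSet.univ_pi (hB k)
  have hD : MeasurableSet (GN \ G) := hGN.diff hG
  -- One average controls three things at once: the mean, the representatives landing in `GN` but
  -- not in `G`, and, through the infinite weight, those landing in the null set where `f` and `f'`
  -- may differ.
  let φ : (Fin d → E) → ℝ≥0∞ := fun x =>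
    S⁻¹ * f' x + (GN \ G).indicator (fun _ => η⁻¹) x + N₀.indicator (fun _ => ∞) x
  have hφ : Measurable φ := ((hf'.const_mul _).add (measurable_const.indicator hD)).add
    (measurable_const.indicator hN₀)
  have hφint : ∫⁻ x, φ x ∂π ≤ 2 := by
    have h1 : ∫⁻ x, f' x ∂π = S := by rw [← hS]; exact (lintegral_congr_ae hf.ae_eq_mk).symm
    have h2 : ∫⁻ x, φ x ∂π = S⁻¹ * S + η⁻¹ * π (GN \ G) + ∞ * π N₀ := by
      simp only [φ]
      rw [lintegral_add_right _ (measurable_const.indicator hN₀),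
        lintegral_add_right _ (measurable_const.indicator hD), lintegral_const_mul _ hf', h1,
        lintegral_indicator_const hD, lintegral_indicator_const hN₀]
    rw [h2, hN₀0, mul_zero, add_zero, ENNReal.inv_mul_cancel hS0 hSt]
    calc (1 : ℝ≥0∞) + η⁻¹ * π (GN \ G) ≤ 1 + η⁻¹ * η := by gcongr
      _ = 2 := by rw [ENNReal.inv_mul_cancel hη hη', one_add_one_eq_two]
  obtain ⟨y, hy, hysum⟩ := exists_representatives (μ := μ) hc hφ
  have hysum2 := hysum.trans hφint
  have hfφ : ∀ x, f x ≤ S * φ x := by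
    intro x
    by_cases hx : x ∈ N₀
    · have : φ x = ∞ := by simp [φ, hx]
      rw [this, ENNReal.mul_top hS0]
      exact le_top
    · rw [hN₀f x hx]
      calc f' x = S * (S⁻¹ * f' x) := by rw [← mul_assoc, ENNReal.mul_inv_cancel hS0 hSt, one_mul]
        _ ≤ S * φ x := by
          gcongr
          exact (le_add_right le_rfl).trans (le_add_right le_rfl)
  refine ⟨ι, hι, c, y, hc, hcδ, ?_, ?_⟩
  · calc _ ≤ ∑ A : Fin d → ι with Function.Injective A,
          (∏ j, μ (c ⁻¹' {A j})) * (S * φ (fun j => y (A j))) := by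
          gcongr
          exact hfφ _
      _ = S * ∑ A : Fin d → ι with Function.Injective A,
          (∏ j, μ (c ⁻¹' {A j})) * φ (fun j => y (A j)) := by
          rw [Finset.mul_sum]
          exact Finset.sum_congr rfl fun A _ => mul_left_comm _ _ _
      _ ≤ S * 2 := by gcongr
      _ = 2 * S := mul_comm _ _
  · let s : Finset (Fin d → ι) := Finset.univ.filter fun A => Function.Injective A ∧
      (fun j => y (A j)) ∈ (GN \ G) ∪ N₀
    have hs : π {x | c ∘ x ∈ s} ≤ 2 * η := by
      rw [hπ, pi_cells_mem_eq_sum hc]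
      have hηφ : ∀ x ∈ (GN \ G) ∪ N₀, 1 ≤ η * φ x := by
        rintro x (hx | hx)
        · calc (1 : ℝ≥0∞) = η * η⁻¹ := (ENNReal.mul_inv_cancel hη hη').symm
            _ ≤ η * φ x := by
              gcongr
              refine le_trans ?_ (le_add_right (le_add_left le_rfl))
              rw [Set.indicator_of_mem hx]
        · have : φ x = ∞ := by simp [φ, hx]
          rw [this, ENNReal.mul_top hη]
          exact le_top
      calc _ ≤ ∑ A ∈ s, (∏ j, μ (c ⁻¹' {A j})) * (η * φ (fun j => y (A j))) := by
            refine Finset.sum_le_sum fun A hA => le_mul_of_one_le_right zero_le ?_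
            exact hηφ _ (Finset.mem_filter.1 hA).2.2
        _ ≤ ∑ A : Fin d → ι with Function.Injective A,
              (∏ j, μ (c ⁻¹' {A j})) * (η * φ (fun j => y (A j))) := by
            refine Finset.sum_le_sum_of_subset fun A hA => ?_
            simp only [Finset.mem_filter, Finset.mem_univ, true_and, s] at hA ⊢
            exact hA.1
        _ = η * ∑ A : Fin d → ι with Function.Injective A,
              (∏ j, μ (c ⁻¹' {A j})) * φ (fun j => y (A j)) := by
            rw [Finset.mul_sum]
            exact Finset.sum_congr rfl fun A _ => mul_left_comm _ _ _
        _ ≤ η * 2 := by gcongr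
        _ = 2 * η := mul_comm _ _
    have hnull : π (⋃ j : Fin d, (fun x => x j) ⁻¹' {z | μ (c ⁻¹' {c z}) = 0}) = 0 := by
      have h1 : {z | μ (c ⁻¹' {c z}) = 0} = ⋃ a ∈ {a | μ (c ⁻¹' {a}) = 0}, c ⁻¹' {a} := by
        ext z
        simp
      have hm : MeasurableSet {z | μ (c ⁻¹' {c z}) = 0} := by
        rw [h1]
        exact MeasurableSet.biUnion (Set.to_countable _) fun a _ => hc a
      refine measure_iUnion_null fun j => ?_
      rw [hπ, (measurePreserving_eval (fun _ : Fin d => μ) j).measure_preimage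
        hm.nullMeasurableSet, h1, measure_biUnion_null_iff (Set.to_countable _)]
      exact fun a ha => ha
    -- Outside these sets, `x` lies in a rectangle of `GN`. Rectangles are resolved by the cells, so
    -- the representatives lie in it too, and then in `G`.
    have hsub : {x | K ≤ f x ∧ ¬ (Function.Injective (c ∘ x) ∧
        (∀ j, μ (c ⁻¹' {c (x j)}) ≠ 0) ∧ K ≤ f fun j => y (c (x j)))}
        ⊆ N₀ ∪ (G \ GN) ∪ {x | ¬ Function.Injective (c ∘ x)} ∪
          (⋃ j : Fin d, (fun x => x j) ⁻¹' {z | μ (c ⁻¹' {c z}) = 0}) ∪ {x | c ∘ x ∈ s} := by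
      rintro x ⟨hx, hxn⟩
      by_contra hno
      simp only [Set.mem_union, not_or] at hno
      obtain ⟨⟨⟨⟨h1, h2⟩, h3⟩, h4⟩, h5⟩ := hno
      have h3' : Function.Injective (c ∘ x) := not_not.1 h3
      have h4' : ∀ j, μ (c ⁻¹' {c (x j)}) ≠ 0 := fun j hj => h4 (Set.mem_iUnion.2 ⟨j, hj⟩)
      have hxG : x ∈ G := by
        have : K ≤ f' x := hN₀f x h1 ▸ hx
        exact this
      have hxGN : x ∈ GN := by
        by_contra hcon
        exact h2 ⟨hxG, hcon⟩
      have hyGN : (fun j => y (c (x j))) ∈ GN := by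
        obtain ⟨k, hk⟩ := Set.mem_iUnion.1 hxGN
        refine Set.mem_iUnion.2 ⟨k, fun j _ => ?_⟩
        exact hcB k j (x j) _ (hy _ (h4' j)).symm (hk j (Set.mem_univ j))
      have h5' : (fun j => y (c (x j))) ∉ (GN \ G) ∪ N₀ := fun hcon =>
        h5 (Finset.mem_filter.2 ⟨Finset.mem_univ _, h3', hcon⟩)
      rw [Set.mem_union, not_or] at h5'
      have hyG : (fun j => y (c (x j))) ∈ G := by
        by_contra hcon
        exact h5'.1 ⟨hyGN, hcon⟩
      refine hxn ⟨h3', h4', ?_⟩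
      rw [hN₀f _ h5'.2]
      exact hyG
    have hinj : π {x | ¬ Function.Injective (c ∘ x)} ≤ η := by
      refine (pi_not_injective_cells_le (κ := Fin d) hc hcδ).trans ?_
      simpa using hδη
    calc _ ≤ π N₀ + π (G \ GN) + π {x | ¬ Function.Injective (c ∘ x)} +
          π (⋃ j : Fin d, (fun x => x j) ⁻¹' {z | μ (c ⁻¹' {c z}) = 0}) + π {x | c ∘ x ∈ s} := by
          refine (measure_mono hsub).trans ((measure_union_le _ _).trans ?_)
          gcongr
          refine (measure_union_le _ _).trans ?_
          gcongr
          refine (measure_union_le _ _).trans ?_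
          gcongr
          exact measure_union_le _ _
      _ ≤ 0 + η + η + 0 + 2 * η := by
          rw [hN₀0, hnull]
          gcongr
      _ = 4 * η := by ring

open Classical in
/-- The union of the half-spaces attached to the fragments of `W` covers all heavy families. -/
theorem exists_halfSpaces_fragments {ι : Type} [Fintype ι] {c : E → ι} (hd : 0 < d)
    (hc : ∀ a, MeasurableSet (c ⁻¹' {a})) (h1 : ∀ a, d * μ (c ⁻¹' {a}) ≤ 1)
    (T : Set (E → ℝ≥0)) (y : ι → E) (s : ℝ≥0∞) (W : Finset ι)
    (hW : ∀ A ∈ heavyFamilies d T y (fun a => μ (c ⁻¹' {a})) s,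
      ¬ Captured initialValues d 0 W A) :
    ∃ (J : Type) (_ : Countable J) (q : J → (E → ℝ≥0) × ℝ≥0), (∀ j, Measurable (q j).1) ∧
      (∀ x : Fin d → E, Function.Injective (c ∘ x) → (∀ j, μ (c ⁻¹' {c (x j)}) ≠ 0) →
        s < supSum T (fun j => y (c (x j))) → ∃ j, x ∈ empiricalHalfSpace d (q j)) ∧
      ∑' j, (Measure.pi fun _ : Fin d => μ) (empiricalHalfSpace d (q j))
        ≤ fragmentCost (heavyFamilies d T y (fun a => μ (c ⁻¹' {a})) s) initialValues d
          (fun a => μ (c ⁻¹' {a})) (3 * d) W := by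
  set b : ι → ℝ≥0∞ := fun a => μ (c ⁻¹' {a}) with hb
  set H := heavyFamilies d T y b s
  let D : Finset (Σ _ : ℕ, Finset ι) := (Finset.Icc 1 d).sigma fun m =>
    Finset.univ.filter fun U => U ∈ fragments H initialValues d m W
  have hq : ∀ p : D, ∃ q : (E → ℝ≥0) × ℝ≥0, Measurable q.1 ∧
      (∀ x : Fin d → E, (∀ a ∈ p.1.2, ∃ j, c (x j) = a) → x ∈ empiricalHalfSpace d q) ∧
      (Measure.pi fun _ : Fin d => μ) (empiricalHalfSpace d q)
        ≤ (3 * d : ℝ≥0∞) ^ p.1.2.card * ∏ a ∈ p.1.2, b a := by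
    rintro ⟨⟨m, U⟩, hp⟩
    simp only [D, Finset.mem_sigma, Finset.mem_filter, Finset.mem_univ, true_and] at hp
    obtain ⟨-, ⟨A, hA, -, hAU⟩, -⟩ := hp
    refine exists_halfSpace_cells hd U hc (fun a ha => ?_) fun a _ => h1 a
    rw [← hAU] at ha
    obtain ⟨i, -, rfl⟩ := Finset.mem_image.1 (Finset.mem_sdiff.1 ha).1
    exact hA.2.1 i
  choose q hqm hqx hqle using hq
  refine ⟨D, inferInstance, q, hqm, ?_, ?_⟩
  · intro x hinj hx0 hx
    obtain ⟨A, hA, hAx⟩ := exists_heavyFamily (b := b) hinj hx0 hx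
    obtain ⟨m, hm1, hmd, U, hU, hUA⟩ := exists_fragment_subset monotone_initialValues hW hA
    refine ⟨⟨⟨m, U⟩, ?_⟩, hqx _ x fun a ha => ?_⟩
    · simp only [D, Finset.mem_sigma, Finset.mem_filter, Finset.mem_univ, true_and,
        Finset.mem_Icc]
      exact ⟨⟨hm1, hmd⟩, hU⟩
    · have := hUA ha
      rw [hAx] at this
      obtain ⟨j, -, hj⟩ := Finset.mem_image.1 this
      exact ⟨j, hj⟩
  · calc _ ≤ ∑' p : D, (3 * d : ℝ≥0∞) ^ p.1.2.card * ∏ a ∈ p.1.2, b a :=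
          ENNReal.tsum_le_tsum hqle
      _ = ∑ p ∈ D, (3 * d : ℝ≥0∞) ^ p.2.card * ∏ a ∈ p.2, b a :=
          Finset.tsum_subtype D fun p => (3 * d : ℝ≥0∞) ^ p.2.card * ∏ a ∈ p.2, b a
      _ = _ := by
          rw [Finset.sum_sigma]
          rfl

/-- The covering theorem for the coordinate process on `E ^ d`. -/
theorem exists_halfSpaces_cover_supSum (hμ : HasNoAtoms μ) (hd : 0 < d) (T : Set (E → ℝ≥0))
    (hT : AEMeasurable (fun x : Fin d → E => supSum T x) (Measure.pi fun _ : Fin d => μ))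
    {S : ℝ≥0∞} (hS : ∫⁻ x, supSum T x ∂(Measure.pi fun _ : Fin d => μ) = S) (hS0 : S ≠ 0)
    (hSt : S ≠ ∞) :
    ∃ (J : Type) (_ : Countable J) (q : J → (E → ℝ≥0) × ℝ≥0), (∀ j, Measurable (q j).1) ∧
      {x : Fin d → E | 49152 * S ≤ supSum T x} ⊆ ⋃ j, empiricalHalfSpace d (q j) ∧
      ∑' j, (Measure.pi fun _ : Fin d => μ) (empiricalHalfSpace d (q j)) ≤ 1 / 2 := by
  have hdE : (d : ℝ≥0∞) ≠ 0 := by exact_mod_cast hd.ne'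
  have hd1 : (1 : ℝ≥0∞) ≤ d := by exact_mod_cast hd
  let Q : ℝ≥0∞ := (1 + d : ℝ≥0∞) ^ d
  have hQ1 : 1 ≤ Q := one_le_pow_of_one_le' (le_add_right le_rfl) d
  have hQ0 : Q ≠ 0 := (lt_of_lt_of_le one_pos hQ1).ne'
  have hQt : Q ≠ ∞ := ENNReal.pow_ne_top (by simp)
  -- Chosen so that the exceptional set costs `Q * (4 * η + η) = 1 / 4`.
  let η : ℝ≥0∞ := (20 * Q)⁻¹
  have hη0 : η ≠ 0 := ENNReal.inv_ne_zero.2 (ENNReal.mul_ne_top (by norm_num) hQt)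
  have hηt : η ≠ ∞ := ENNReal.inv_ne_top.2 (mul_ne_zero (by norm_num) hQ0)
  have hη1 : η ≤ 1 := by
    rw [ENNReal.inv_le_one]
    exact hQ1.trans (le_mul_of_one_le_left zero_le (by norm_num))
  let m : ℝ≥0∞ := (768 * d) ^ 2
  have hm0 : m ≠ 0 := pow_ne_zero _ (mul_ne_zero (by norm_num) hdE)
  have hmt : m ≠ ∞ := ENNReal.pow_ne_top (ENNReal.mul_ne_top (by norm_num) (ENNReal.natCast_ne_top d))
  -- Makes a collision among `768 * d` sample points have probability at most `1 / 8`, and one among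
  -- `d` points at most `η`.
  let δ : ℝ≥0∞ := m⁻¹ * (η * 8⁻¹)
  have hδ0 : δ ≠ 0 := mul_ne_zero (ENNReal.inv_ne_zero.2 hmt) (mul_ne_zero hη0 (by simp))
  have hmδ : m * δ = η * 8⁻¹ := by
    rw [← mul_assoc, ENNReal.mul_inv_cancel hm0 hmt, one_mul]
  have h8 : (8 : ℝ≥0∞)⁻¹ ≤ 1 := ENNReal.inv_le_one.2 (by norm_num)
  have hdm : (d : ℝ≥0∞) ^ 2 ≤ m := by
    refine pow_le_pow_left₀ zero_le (le_mul_of_one_le_left zero_le (by norm_num)) 2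
  have hmδη : m * δ ≤ η := hmδ.le.trans (mul_le_of_le_one_right zero_le h8)
  obtain ⟨ι, hι, c, y, hc, hcδ, hmean, hexc⟩ := exists_cells_representatives hμ hd hT hS hS0 hSt
    (49152 * S) hη0 hηt hδ0 (le_trans (by gcongr) hmδη)
  have hcd : ∀ a, d * μ (c ⁻¹' {a}) ≤ 1 := by
    intro a
    calc _ ≤ (d : ℝ≥0∞) ^ 2 * δ := by
          gcongr
          · rw [sq]; exact le_mul_of_one_le_left zero_le hd1
          · exact hcδ a
      _ ≤ m * δ := by gcongr
      _ ≤ 1 := hmδη.trans hη1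
  classical
  obtain ⟨L, hL⟩ : ∃ L : ℕ, L = 768 := ⟨_, rfl⟩
  have hinj : 1 ≤ ∑ A : Fin L × Fin d → ι with Function.Injective A, ∏ p, μ (c ⁻¹' {A p})
      + 1 / 8 := by
    refine (one_le_sum_injective_add (κ := Fin L × Fin d) hc hcδ).trans ?_
    have hcard : (Fintype.card (Fin L × Fin d) : ℝ≥0∞) ^ 2 * δ ≤ 1 / 8 := by
      have : (Fintype.card (Fin L × Fin d) : ℝ≥0∞) = 768 * d := by
        simp [hL]
      rw [this, one_div]
      exact hmδ.le.trans (mul_le_of_le_one_left zero_le hη1)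
    gcongr
  obtain ⟨W, hW, hWcost⟩ := exists_uncaptured_fragmentCost_le (T := T) (y := y)
    (b := fun a => μ (c ⁻¹' {a})) (sum_measure_cells hc).le hS0 hSt hmean hL hinj
  obtain ⟨J, hJ, q, hqm, hqx, hqsum⟩ := exists_halfSpaces_fragments hd hc hcd T y _ W hW
  -- Only the outer measure of this set is controlled, which is all that a cover needs.
  obtain ⟨q', hqm', hqx', hqsum'⟩ := exists_halfSpace_cover (μ := μ) hd
    {x | 49152 * S ≤ supSum T x ∧ ¬ (Function.Injective (c ∘ x) ∧
        (∀ j, μ (c ⁻¹' {c (x j)}) ≠ 0) ∧ 49152 * S ≤ supSum T fun j => y (c (x j)))} hη0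
  refine ⟨J ⊕ ℕ, inferInstance, Sum.elim q q', ?_, ?_, ?_⟩
  · rintro (j | k)
    · exact hqm j
    · exact hqm' k
  · intro x hx
    by_cases hgood : Function.Injective (c ∘ x) ∧
        (∀ j, μ (c ⁻¹' {c (x j)}) ≠ 0) ∧ 49152 * S ≤ supSum T fun j => y (c (x j))
    -- Doubling the constant turns the weak inequality into the strict one defining heavy families.
    · have hlt : 24576 * S < 49152 * S :=
        (ENNReal.mul_lt_mul_iff_left hS0 hSt).2 (by norm_num)
      obtain ⟨j, hj⟩ := hqx x hgood.1 hgood.2.1 (hlt.trans_le hgood.2.2)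
      exact Set.mem_iUnion.2 ⟨Sum.inl j, hj⟩
    · obtain ⟨k, hk⟩ := Set.mem_iUnion.1 (hqx' ⟨hx, hgood⟩)
      exact Set.mem_iUnion.2 ⟨Sum.inr k, hk⟩
  · rw [ENNReal.summable.tsum_sum ENNReal.summable]
    have h1 : Q * (4 * η + η) = 1 / 4 := by
      calc _ = (Q * 20 * (20 * Q)⁻¹) * 4⁻¹ := by
            have : (20 : ℝ≥0∞) * 4⁻¹ = 5 := by
              rw [show (20 : ℝ≥0∞) = 5 * 4 by norm_num, mul_assoc,
                ENNReal.mul_inv_cancel (by norm_num) (by norm_num), mul_one]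
            calc _ = Q * (5 * η) := by ring
              _ = Q * ((20 * 4⁻¹) * (20 * Q)⁻¹) := by rw [this]
              _ = _ := by ring
        _ = 1 / 4 := by
            rw [mul_comm Q, ENNReal.mul_inv_cancel (mul_ne_zero (by norm_num) hQ0)
              (ENNReal.mul_ne_top (by norm_num) hQt), one_mul, one_div]
    calc _ ≤ (1 / 4 : ℝ≥0∞) + 1 / 4 := by
          refine add_le_add (hqsum.trans hWcost) (hqsum'.trans (le_trans ?_ h1.le))
          gcongr
      _ = 1 / 2 := by
          rw [← two_mul, show (4 : ℝ≥0∞) = 2 * 2 by norm_num, one_div, one_div,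
            ENNReal.mul_inv (Or.inl (by norm_num)) (Or.inl (by norm_num)), ← mul_assoc,
            ENNReal.mul_inv_cancel (by norm_num) (by norm_num), one_mul]

end Main

theorem mainTheorem3 :
    ∃ K : ℝ≥0, 0 < K ∧
      ∀ (E : Type*) [MetricSpace E] [MeasurableSpace E] [BorelSpace E]
        (μ : Measure E) [IsProbabilityMeasure μ], HasNoAtoms μ →
      ∀ (d : ℕ), 0 < d →
      ∀ (T : Set (E → ℝ≥0)), (∀ t ∈ T, Measurable t) →
        AEMeasurable (fun x : Fin d → E => supSum T x) (Measure.pi fun _ : Fin d => μ) →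
      ∀ (Ω : Type*) [MeasurableSpace Ω] (P : Measure Ω) [IsProbabilityMeasure P]
        (X : Fin d → Ω → E), (∀ i, Measurable (X i)) → (∀ i, P.map (X i) = μ) →
        iIndepFun X P →
      ∀ S : ℝ≥0∞, S = ∫⁻ ω, supSum T (fun i => X i ω) ∂P → 0 < S → S < ∞ →
      ∃ F : Set ((E → ℝ≥0) × ℝ≥0), F.Countable ∧ (∀ q ∈ F, Measurable q.1) ∧
        {ω | (K : ℝ≥0∞) * S ≤ supSum T (fun i => X i ω)} ⊆
          ⋃ q ∈ F, {ω | q.2 ≤ (1 / (d : ℝ≥0)) * ∑ i, q.1 (X i ω)} ∧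
        ∑' q : F, P {ω | q.1.2 ≤ (1 / (d : ℝ≥0)) * ∑ i, q.1.1 (X i ω)} ≤ 1 / 2 := by
  refine ⟨49152, by norm_num, ?_⟩
  intro E _ _ _ μ _ hμ d hd T _ hT Ω _ P _ X hX hXμ hind S hS hS0 hSt
  have hXm : Measurable fun ω i => X i ω := measurable_pi_lambda _ hX
  have hmap : P.map (fun ω i => X i ω) = Measure.pi fun _ : Fin d => μ := by
    rw [hind.map_fun_eq_pi_map fun i => (hX i).aemeasurable]
    simp only [hXμ]
  have hS' : ∫⁻ x, supSum T x ∂(Measure.pi fun _ : Fin d => μ) = S := by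
    rw [hS, ← hmap, lintegral_map' (hmap ▸ hT) hXm.aemeasurable]
  obtain ⟨J, _, q, hqm, hqx, hqsum⟩ :=
    exists_halfSpaces_cover_supSum hμ hd T hT hS' hS0.ne' hSt.ne
  refine ⟨Set.range q, Set.countable_range q, ?_, ?_, ?_⟩
  · rintro _ ⟨j, rfl⟩
    exact hqm j
  · intro ω hω
    have hω' : (49152 : ℝ≥0∞) * S ≤ supSum T fun i => X i ω := hω
    obtain ⟨j, hj⟩ := Set.mem_iUnion.1 (hqx (show (fun i => X i ω) ∈ _ from hω'))
    exact Set.mem_biUnion ⟨j, rfl⟩ hj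
  -- Passing from the indexed family to its range merges repeated half-spaces, which can only lower
  -- the sum.
  · refine le_trans (ENNReal.tsum_le_tsum_comp_of_surjective Set.rangeFactorization_surjective
      fun p : Set.range q => P {ω | p.1.2 ≤ (1 / (d : ℝ≥0)) * ∑ i, p.1.1 (X i ω)}) ?_
    refine le_trans (ENNReal.tsum_le_tsum fun j => ?_) hqsum
    rw [← hmap, Measure.map_apply hXm (measurableSet_empiricalHalfSpace (hqm j))]
    exact le_rfl
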